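/- **Conventions.** A sequence of partitions of $[0,1]$ is $\pi=(\pi^n)_{n\ge1}$, $\pi^n=(0=t^n_0<t^n_1<\dots<t^n_{N(\pi^n)}=1)$, and we put $\pi^0=\{0,1\}$. Let $|\pi^n|$ and $\underline{\pi^n}$ be the largest and the smallest interval length of $\pi^n$. The sequence $\pi$ is *finitely refining* if $\pi^n\subseteq\pi^{n+1}$ for all $n \geq 1$, $|\pi^n|\to0$, and for some $M<\infty$ and every $n\ge1$ there are at most $M$ points of $\pi^{n+1}$ between any two consecutive points of $\pi^n$; *balanced* if $\sup_{n\ge1}|\pi^n|/\underline{\pi^n}<\infty$; *complete refining* if there are $\epsilon,M>0$ with $1+\epsilon\le|\pi^n|/|\pi^{n+1}|\le M$ for all $n\ge1$. A *coarsening* of a finitely refining $\pi$ is a finitely refining sequence $\sigma=(\sigma^n)_{n\ge1}$ with $\sigma^n\subseteq\pi^n$ for all $n \geq 1$. *Haar and Schauder functions.* For $m\ge0$ and $0\le k<N(\pi^m)$ let $p(m,k)=\inf\{j\ge 0:t^{m+1}_j\ge t^m_k\}$, and for $2\le i\le p(m,k+1)-p(m,k)$ put $t_1=t^{m+1}_{p(m,k)}$,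 $t_2=t^{m+1}_{p(m,k)+i-1}$, $t_3=t^{m+1}_{p(m,k)+i}$. Then $\psi_{m,k,i}$ equals $\left(\frac{t_3-t_2}{t_2-t_1}\cdot\frac1{t_3-t_1}\right)^{1/2}$ on $[t_1,t_2)$, $-\left(\frac{t_2-t_1}{t_3-t_2}\cdot\frac1{t_3-t_1}\right)^{1/2}$ on $[t_2,t_3)$ and $0$ elsewhere, and $e^\pi_{m,k,i}(t)=\int_0^t\psi_{m,k,i}(u)\,du$. *The class $\mathcal A^\pi$.* Let $\pi$ be finitely refining. A real process $x=(x(t))_{t\in[0,1]}$ on a probability space belongs to $\mathcal A^\pi$ if there are random variables $\eta_{m,k,i}$ such that almost surely, for all $t\in[0,1]$, $$x(t)=x(0)+(x(1)-x(0))\,t+\sum_{m=0}^\infty\sum_{k,i}\eta_{m,k,i}\,e^\pi_{m,k,i}(t),$$ where, writing $a,b,c,d$ for index triples $(m,k,i)$: $\mathbb E\eta_a=0$; $\mathbb E(\eta_a\eta_b)=\mathbf 1_{a=b}$; $\sup_a\mathbb E\eta_a^4<\infty$; and $\mathbb E(\eta_a^\alpha\eta_b^\beta\eta_c^\gamma\eta_d^\delta)=\mathbb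 E(\eta_a^\alpha)\,\mathbb E(\eta_b^\beta)\,\mathbb E(\eta_c^\gamma)\,\mathbb E(\eta_d^\delta)$ for all pairwise distinct $a,b,c,d$ and all integers $\alpha,\beta,\gamma,\delta\ge0$ with $\alpha+\beta+\gamma+\delta=4$. *Quadratic variation.* For a path $x$ on $[0,1]$ let $[x]_{\pi^n}(t)=\sum_{i<N(\pi^n)}\left(x(t^n_{i+1}\wedge t)-x(t^n_i\wedge t)\right)^2$. The set $Q_\pi([0,1],\mathbb R)$ consists of the càdlàg paths $x$ for which the measures $\sum_{j<N(\pi^n)}(x(t^n_{j+1})-x(t^n_j))^2\delta_{t^n_j}$ converge weakly to a finite measure $\mu$ on $[0,1]$ such that $t\mapsto\mu([0,t])-\sum_{0<s\le t}|\Delta x(s)|^2$ is continuous and increasing (non-decreasing), and $\mu([0,t])=\lim_n[x]_{\pi^n}(t)$ for all $t\in[0,1]$; then $[x]_\pi(t)=\mu([0,t])$. **Theorem (Invariance of quadratic variation).** Let $\pi$ be a finitely refining sequence of partitions of $[0,1]$, let $x\in\mathcal A^\pi$, and let $\sigma$ be a coarsening of $\pi$. Then for every $t\in[0,1]$, $$[x]_{\sigma^n}(t)\to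 t\quad\text{and}\quad[x]_{\pi^n}(t)\to t\qquad\text{in probability as }n\to\infty.$$ If moreover $\pi$ and $\sigma$ are both complete refining and balanced, then almost surely $x\in Q_\pi([0,1],\mathbb R)\cap Q_\sigma([0,1],\mathbb R)$ and $[x]_\pi(t)=[x]_\sigma(t)$ for all $t\in[0,1]$. -/

import Mathlib

open Set Filter Topology MeasureTheory

noncomputable section

/-- A finite partition `0 = t_0 < t_1 < ⋯ < t_N = 1` of the unit interval;
the values `t k` for `k > N` play no role. -/
structure UnitPartition where
  N : ℕ
  t : ℕ → ℝ
  t_zero : t 0 = 0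
  t_last : t N = 1
  t_lt : ∀ k < N, t k < t (k + 1)

namespace UnitPartition

/-- The set of partition points. -/
def points (P : UnitPartition) : Finset ℝ := (Finset.range (P.N + 1)).image P.t

/-- The length of the largest interval. -/
def mesh (P : UnitPartition) : ℝ := ⨆ i : Fin P.N, (P.t (i + 1) - P.t i)

/-- The length of the smallest interval. -/
def minMesh (P : UnitPartition) : ℝ := ⨅ i : Fin P.N, (P.t (i + 1) - P.t i)

/-- `∑ᵢ (x(t_{i+1} ∧ t) - x(t_i ∧ t))²`, the quadratic variation of a path along one partition. -/
def qv (P : UnitPartition) (x : ℝ → ℝ) (t : ℝ) : ℝ :=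
  ∑ i ∈ Finset.range P.N, (x (min (P.t (i + 1)) t) - x (min (P.t i) t)) ^ 2

/-- The unit point mass at `s`. -/
def pointMass (s : ℝ) : FiniteMeasure ℝ := ⟨Measure.dirac s, inferInstance⟩

/-- The measure `∑ᵢ (x(t_{i+1}) - x(t_i))² δ_{t_i}`. -/
def qvMeasure (P : UnitPartition) (x : ℝ → ℝ) : FiniteMeasure ℝ :=
  ∑ i ∈ Finset.range P.N,
    Real.toNNReal ((x (P.t (i + 1)) - x (P.t i)) ^ 2) • pointMass (P.t i)

end UnitPartition

/-- A sequence `(π^n)_{n ≥ 1}` of partitions of `[0,1]`, together with the convention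
`π^0 = {0, 1}` that is used for the level `m = 0` of the Haar system. -/
structure PartitionSeq where
  part : ℕ → UnitPartition
  part_zero : (part 0).N = 1

namespace PartitionSeq

/-- Number of intervals of `π^n`. -/
abbrev N (π : PartitionSeq) (n : ℕ) : ℕ := (π.part n).N

/-- The point `t^n_k`. -/
abbrev t (π : PartitionSeq) (n k : ℕ) : ℝ := (π.part n).t k

abbrev mesh (π : PartitionSeq) (n : ℕ) : ℝ := (π.part n).mesh

abbrev minMesh (π : PartitionSeq) (n : ℕ) : ℝ := (π.part n).minMesh

def Refining (π : PartitionSeq) : Prop :=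
  ∀ n, 1 ≤ n → (π.part n).points ⊆ (π.part (n + 1)).points

/-- Refining, with vanishing mesh, and with a uniform bound on the number of points of `π^{n+1}`
between two consecutive points of `π^n`. -/
structure FinitelyRefining (π : PartitionSeq) : Prop where
  refining : π.Refining
  mesh_tendsto : Tendsto π.mesh atTop (𝓝 0)
  bounded_branching : ∃ M : ℕ, ∀ n, 1 ≤ n → ∀ k < π.N n,
    ((π.part (n + 1)).points.filter (fun s => π.t n k ≤ s ∧ s ≤ π.t n (k + 1))).card ≤ M

def Balanced (π : PartitionSeq) : Prop :=
  ∃ c : ℝ, 0 < c ∧ ∀ n, 1 ≤ n → π.mesh n / π.minMesh n ≤ c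

def CompleteRefining (π : PartitionSeq) : Prop :=
  ∃ ε M : ℝ, 0 < ε ∧ 0 < M ∧
    ∀ n, 1 ≤ n → 1 + ε ≤ π.mesh n / π.mesh (n + 1) ∧ π.mesh n / π.mesh (n + 1) ≤ M

/-- `σ` is a coarsening of `π`: each `σ^n` is a subpartition of `π^n`, and `σ` is itself
finitely refining. -/
structure IsCoarsening (σ π : PartitionSeq) : Prop where
  subset : ∀ n, 1 ≤ n → (σ.part n).points ⊆ (π.part n).points
  finitelyRefining : σ.FinitelyRefining

/-! Haar and Schauder systems -/

/-- `p(n,k) = inf {j ≥ 0 : t^{n+1}_j ≥ t^n_k}`. -/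
def p (π : PartitionSeq) (n k : ℕ) : ℕ := sInf {j : ℕ | π.t n k ≤ π.t (n + 1) j}

/-- The indices `i` of the Haar functions of level `m` living on `[t^m_k, t^m_{k+1})`. The index
`i` corresponds to the point `t^{m+1}_{p(m,k)+i-1}`, which has to be a point of `π^{m+1}` that is
not in `π^m`, so that `i` starts from `2`. -/
def branchIndex (π : PartitionSeq) (m k : ℕ) : Finset ℕ :=
  Finset.Icc 2 (π.p m (k + 1) - π.p m k)

/-- The index set of the Haar system: the triples `(m, k, i)`. -/
def haarIndex (π : PartitionSeq) : Set (ℕ × ℕ × ℕ) :=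
  {a | a.2.1 < π.N a.1 ∧ a.2.2 ∈ π.branchIndex a.1 a.2.1}

/-- The Haar function `ψ_{m,k,i}`. -/
def haar (π : PartitionSeq) (m k i : ℕ) (u : ℝ) : ℝ :=
  let t₁ := π.t (m + 1) (π.p m k)
  let t₂ := π.t (m + 1) (π.p m k + i - 1)
  let t₃ := π.t (m + 1) (π.p m k + i)
  if t₁ ≤ u ∧ u < t₂ then Real.sqrt ((t₃ - t₂) / (t₂ - t₁) * (1 / (t₃ - t₁)))
  else if t₂ ≤ u ∧ u < t₃ then -Real.sqrt ((t₂ - t₁) / (t₃ - t₂) * (1 / (t₃ - t₁)))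
  else 0

/-- The Schauder function `e_{m,k,i}(t) = ∫₀ᵗ ψ_{m,k,i}(u) du`. -/
def schauder (π : PartitionSeq) (m k i : ℕ) (t : ℝ) : ℝ :=
  ∫ u in (0 : ℝ)..t, π.haar m k i u

/-- `a + b t + ∑_{m < n} ∑_{k,i} θ_{m,k,i} e_{m,k,i}(t)`. -/
def schauderPartialSum (π : PartitionSeq) (a b : ℝ) (θ : ℕ × ℕ × ℕ → ℝ) (n : ℕ) (t : ℝ) : ℝ :=
  a + b * t + ∑ m ∈ Finset.range n, ∑ k ∈ Finset.range (π.N m), ∑ i ∈ π.branchIndex m k,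
    θ (m, k, i) * π.schauder m k i t

/-! Pathwise quadratic variation -/

/-- `f` is right-continuous with left limits on `[0,1]`. -/
def _root_.IsCadlagUnit (f : ℝ → ℝ) : Prop :=
  (∀ t ∈ Ico (0 : ℝ) 1, ContinuousWithinAt f (Icc t 1) t) ∧
    ∀ t ∈ Ioc (0 : ℝ) 1, ∃ l, Tendsto f (𝓝[<] t) (𝓝 l)

/-- The jump `f(s) - f(s-)`. -/
def _root_.jump (f : ℝ → ℝ) (s : ℝ) : ℝ := f s - Function.leftLim f s

/-- The càdlàg path `x` on `[0,1]` has finite quadratic variation `q` along `π`: the measures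
`∑ⱼ (x(t^n_{j+1}) - x(t^n_j))² δ_{t^n_j}` converge weakly to a finite measure `μ` (all of them live
on `[0,1]`, hence so does `μ`) such that `μ [0,t] - ∑_{0<s≤t} |Δx(s)|²` is continuous and
increasing, and `q(t) = μ [0,t] = lim_n [x]_{π^n}(t)`. -/
structure HasQuadVar (π : PartitionSeq) (x q : ℝ → ℝ) : Prop where
  cadlag : IsCadlagUnit x
  summable_jumps : Summable (fun s : Ioc (0 : ℝ) 1 => jump x s ^ 2)
  exists_measure : ∃ μ : FiniteMeasure ℝ,
    Tendsto (fun n => (π.part n).qvMeasure x) atTop (𝓝 μ) ∧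
    ContinuousOn (fun t => (μ : Measure ℝ).real (Icc 0 t) - ∑' s : Ioc (0 : ℝ) t, jump x s ^ 2)
      (Icc 0 1) ∧
    MonotoneOn (fun t => (μ : Measure ℝ).real (Icc 0 t) - ∑' s : Ioc (0 : ℝ) t, jump x s ^ 2)
      (Icc 0 1) ∧
    ∀ t ∈ Icc (0 : ℝ) 1, q t = (μ : Measure ℝ).real (Icc 0 t)
  tendsto_qv : ∀ t ∈ Icc (0 : ℝ) 1, Tendsto (fun n => (π.part n).qv x t) atTop (𝓝 (q t))

/-- The class `Q_π([0,1], ℝ)`. -/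
def Q (π : PartitionSeq) : Set (ℝ → ℝ) := {x | ∃ q, π.HasQuadVar x q}

open Classical in
/-- The quadratic variation `[x]_π` of a path `x ∈ Q_π`; set to `0` if `x ∉ Q_π`. -/
def quadVar (π : PartitionSeq) (x : ℝ → ℝ) : ℝ → ℝ :=
  if h : ∃ q, π.HasQuadVar x q then Classical.choose h else 0

/-- The class `𝒜^π` of processes `x = (x(t))_{t ∈ [0,1]}` on a probability space: almost surely
`x` has a Schauder expansion along `π`, whose random coefficients `η_{m,k,i}` are centred and
orthonormal, have bounded fourth moments, and satisfy the fourth order moment factorisation. -/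
def ClassA {Ω : Type*} [MeasurableSpace Ω] (π : PartitionSeq) (μ : Measure Ω)
    (x : ℝ → Ω → ℝ) : Prop :=
  (∀ t ∈ Icc (0 : ℝ) 1, AEMeasurable (x t) μ) ∧
  ∃ η : ℕ × ℕ × ℕ → Ω → ℝ,
    (∀ᵐ ω ∂μ, ∀ t ∈ Icc (0 : ℝ) 1,
      Tendsto (fun n => π.schauderPartialSum (x 0 ω) (x 1 ω - x 0 ω) (fun a => η a ω) n t)
        atTop (𝓝 (x t ω))) ∧
    (∀ a ∈ π.haarIndex, MemLp (η a) 4 μ) ∧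
    (∀ a ∈ π.haarIndex, ∫ ω, η a ω ∂μ = 0) ∧
    (∀ a ∈ π.haarIndex, ∀ b ∈ π.haarIndex,
      ∫ ω, η a ω * η b ω ∂μ = if a = b then 1 else 0) ∧
    (∃ M : ℝ, ∀ a ∈ π.haarIndex, ∫ ω, η a ω ^ 4 ∂μ ≤ M) ∧
    (∀ a ∈ π.haarIndex, ∀ b ∈ π.haarIndex, ∀ c ∈ π.haarIndex, ∀ d ∈ π.haarIndex,
      [a, b, c, d].Nodup → ∀ i j k l : ℕ, i + j + k + l = 4 →
      ∫ ω, η a ω ^ i * η b ω ^ j * η c ω ^ k * η d ω ^ l ∂μ =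
        (∫ ω, η a ω ^ i ∂μ) * (∫ ω, η b ω ^ j ∂μ) * (∫ ω, η c ω ^ k ∂μ) * (∫ ω, η d ω ^ l ∂μ))

end PartitionSeq

end

/-! Put H_k(s) for the length of the part of the k-th interval of π^n lying in [0,s], and K_n(s,t) =
∑_k H_k(s) H_k(t) / |I_k|. Level m of the Schauder system contributes exactly K_{m+1} - K_m to ∑
e_a(s) e_a(t). Hence the expansion truncated at level n has covariance K_n(s,t) - st
(`Refining.sum_trunc_schauder_mul`), which tends to the Brownian bridge covariance min(s,t) - st.

Along any single partition P, the quadratic variation of a truncated expansion is its mean plus a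
centred quadratic form in the η_a. Fourth order factorisation bounds the variance of the form by its
squared Frobenius norm (`integral_sq_sum_centredMul_le`). That norm equals the norm of the Gram
matrix of the increments over P, and its square is at most 2|P| uniformly in n
(`Refining.sum_sq_gram_le`). The mean tends to t up to an error |P|. Fatou's lemma then gives
E([y]_P(t) - t)² ≤ C|P| for the series y without its affine part (`lintegral_qv_sub_le`), for every
partition P, related to π or not.

Summable meshes therefore give almost sure convergence, and the affine part of x is removed
pathwise. Convergence in probability follows by passing to subsequences with summable mesh.

In the complete refining case the meshes decay geometrically. Balance then makes the number of
coefficients per level comparable to the inverse mesh, so fourth moments and the M-test yield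
continuous paths (`ClassA.ae_continuousOn`). For a continuous path, convergence to t at all rational
times extends by monotonicity to all times and to weak convergence to Lebesgue measure
(`hasQuadVar_of_tendsto_rat`). Both quadratic variations are then equal to t. -/

noncomputable section

/-! ### Geometry of a single partition and its covariance kernel. -/

namespace UnitPartition

variable (P : UnitPartition)

theorem N_pos : 0 < P.N := by
  rcases Nat.eq_zero_or_pos P.N with h | h
  · have h0 := P.t_zero
    have h1 := P.t_last
    rw [h, h0] at h1
    norm_num at h1
  · exact h

theorem t_strictMono {i j : ℕ} (hij : i < j) (hj : j ≤ P.N) : P.t i < P.t j := by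
  induction j, hij using Nat.le_induction with
  | base => exact P.t_lt i (by omega)
  | succ j hij ih => exact (ih (by omega)).trans (P.t_lt j (by omega))

theorem t_mono {i j : ℕ} (hij : i ≤ j) (hj : j ≤ P.N) : P.t i ≤ P.t j := by
  rcases hij.lt_or_eq with h | rfl
  · exact (P.t_strictMono h hj).le
  · exact le_rfl

theorem t_injOn {i j : ℕ} (hi : i ≤ P.N) (hj : j ≤ P.N) (h : P.t i = P.t j) : i = j := by
  rcases lt_trichotomy i j with hij | hij | hij
  · exact absurd h (P.t_strictMono hij hj).ne
  · exact hij
  · exact absurd h (P.t_strictMono hij hi).ne'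

theorem lt_of_t_lt {i j : ℕ} (hi : i ≤ P.N) (h : P.t i < P.t j) : i < j := by
  by_contra hji
  exact absurd (P.t_mono (not_lt.1 hji) hi) (not_le.2 h)

theorem t_nonneg {i : ℕ} (hi : i ≤ P.N) : 0 ≤ P.t i :=
  P.t_zero ▸ P.t_mono (Nat.zero_le i) hi

theorem t_le_one {i : ℕ} (hi : i ≤ P.N) : P.t i ≤ 1 :=
  P.t_last ▸ P.t_mono hi le_rfl

theorem length_pos {i : ℕ} (hi : i < P.N) : 0 < P.t (i + 1) - P.t i :=
  sub_pos.2 (P.t_lt i hi)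

theorem length_le_mesh {i : ℕ} (hi : i < P.N) : P.t (i + 1) - P.t i ≤ P.mesh :=
  le_ciSup (f := fun i : Fin P.N => P.t (i + 1) - P.t i) (Set.finite_range _).bddAbove ⟨i, hi⟩

theorem minMesh_le_length {i : ℕ} (hi : i < P.N) : P.minMesh ≤ P.t (i + 1) - P.t i :=
  ciInf_le (f := fun i : Fin P.N => P.t (i + 1) - P.t i) (Set.finite_range _).bddBelow ⟨i, hi⟩

theorem mesh_pos : 0 < P.mesh := (P.length_pos P.N_pos).trans_le (P.length_le_mesh P.N_pos)

theorem mesh_le_one : P.mesh ≤ 1 := by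
  have : Nonempty (Fin P.N) := ⟨⟨0, P.N_pos⟩⟩
  refine ciSup_le fun i => ?_
  linarith [P.t_le_one (i := i + 1) i.2, P.t_nonneg (i := i) i.2.le]

theorem minMesh_pos : 0 < P.minMesh := by
  have : Nonempty (Fin P.N) := ⟨⟨0, P.N_pos⟩⟩
  obtain ⟨i, hi⟩ := exists_eq_ciInf_of_finite (f := fun i : Fin P.N => P.t (i + 1) - P.t i)
  rw [minMesh, ← hi]
  exact P.length_pos i.2

theorem sum_sub (f : ℝ → ℝ) :
    ∑ i ∈ Finset.range P.N, (f (P.t (i + 1)) - f (P.t i)) = f 1 - f 0 := by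
  rw [Finset.sum_range_sub (fun i => f (P.t i)), P.t_last, P.t_zero]

theorem N_mul_minMesh_le : P.N * P.minMesh ≤ 1 := by
  have h := Finset.card_nsmul_le_sum (Finset.range P.N) (fun i => P.t (i + 1) - P.t i) P.minMesh
    fun i hi => P.minMesh_le_length (Finset.mem_range.1 hi)
  rw [P.sum_sub (fun x => x)] at h
  simpa using h

theorem one_le_N_mul_mesh : 1 ≤ P.N * P.mesh := by
  have h := Finset.sum_le_card_nsmul (Finset.range P.N) (fun i => P.t (i + 1) - P.t i) P.mesh
    fun i hi => P.length_le_mesh (Finset.mem_range.1 hi)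
  rw [P.sum_sub (fun x => x)] at h
  simpa using h

theorem mem_points {s : ℝ} : s ∈ P.points ↔ ∃ i ≤ P.N, P.t i = s := by
  simp [points]

theorem exists_mem_interval {s : ℝ} (hs : s ∈ Ico (0 : ℝ) 1) :
    ∃ i < P.N, P.t i ≤ s ∧ s < P.t (i + 1) := by
  have hex : ∃ j, j ≤ P.N ∧ s < P.t j := ⟨P.N, le_rfl, by rw [P.t_last]; exact hs.2⟩
  classical
  have hspec := Nat.find_spec hex
  have hne : Nat.find hex ≠ 0 := by
    intro h0
    rw [h0, P.t_zero] at hspec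
    exact absurd hs.1 (not_le.2 hspec.2)
  obtain ⟨i, hi⟩ := Nat.exists_eq_succ_of_ne_zero hne
  rw [hi] at hspec
  refine ⟨i, hspec.1, ?_, hspec.2⟩
  by_contra h
  exact Nat.find_min hex (m := i) (by omega) ⟨by omega, not_le.1 h⟩

/-- The length of `[t_i, t_{i+1}] ∩ [0, s]`. -/
def overlap (i : ℕ) (s : ℝ) : ℝ := min (P.t (i + 1)) s - min (P.t i) s

theorem overlap_nonneg {i : ℕ} (hi : i < P.N) (s : ℝ) : 0 ≤ P.overlap i s :=
  sub_nonneg.2 (min_le_min_right _ (P.t_lt i hi).le)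

theorem overlap_mono {i : ℕ} (hi : i < P.N) {s s' : ℝ} (h : s ≤ s') :
    P.overlap i s ≤ P.overlap i s' := by
  have := P.t_lt i hi
  unfold overlap
  rcases min_cases (P.t (i + 1)) s with h1 | h1 <;> rcases min_cases (P.t (i + 1)) s' with h2 | h2 <;>
  rcases min_cases (P.t i) s with h3 | h3 <;> rcases min_cases (P.t i) s' with h4 | h4 <;> linarith

theorem overlap_le {i : ℕ} (hi : i < P.N) (s : ℝ) : P.overlap i s ≤ P.t (i + 1) - P.t i := by
  have := P.t_lt i hi
  unfold overlap
  rcases min_cases (P.t (i + 1)) s with h1 | h1 <;>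
  rcases min_cases (P.t i) s with h3 | h3 <;> linarith

theorem overlap_zero {i : ℕ} (hi : i < P.N) : P.overlap i 0 = 0 := by
  rw [overlap, min_eq_right (P.t_nonneg hi), min_eq_right (P.t_nonneg hi.le), sub_zero]

theorem sum_overlap {s : ℝ} (hs : s ∈ Icc (0 : ℝ) 1) :
    ∑ i ∈ Finset.range P.N, P.overlap i s = s := by
  have := P.sum_sub (fun u => min u s)
  simp only [min_eq_right hs.2, min_eq_left hs.1, sub_zero] at this
  exact this

/-- The covariance kernel of the piecewise linear interpolation of Brownian motion along `P`. -/
def kernel (s t : ℝ) : ℝ :=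
  ∑ i ∈ Finset.range P.N, P.overlap i s * P.overlap i t / (P.t (i + 1) - P.t i)

theorem kernel_comm (s t : ℝ) : P.kernel s t = P.kernel t s := by
  simp only [kernel, mul_comm]

/-- The difference is ∑ H_i(s)(1 - H_i(t)/|I_i|), with H_i the overlap. The second factor vanishes
for intervals ending by t, the first for intervals starting after t ≥ s, so only the interval around
t can contribute. -/
theorem min_sub_kernel_mem {s t : ℝ} (hs : s ∈ Icc (0 : ℝ) 1) (hst : s ≤ t) :
    s - P.kernel s t ∈ Icc 0 P.mesh := by
  have key : s - P.kernel s t = ∑ i ∈ Finset.range P.N,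
      P.overlap i s * (1 - P.overlap i t / (P.t (i + 1) - P.t i)) := by
    rw [show s - P.kernel s t = (∑ i ∈ Finset.range P.N, P.overlap i s) - P.kernel s t by
      rw [P.sum_overlap hs], kernel, ← Finset.sum_sub_distrib]
    exact Finset.sum_congr rfl fun i _ => by ring
  rw [key]
  constructor
  · refine Finset.sum_nonneg fun i hi => ?_
    have hi := Finset.mem_range.1 hi
    refine mul_nonneg (P.overlap_nonneg hi s) (sub_nonneg.2 ?_)
    rw [div_le_one (P.length_pos hi)]
    exact P.overlap_le hi t
  -- The increments of this step function single out the interval containing t, and they telescope.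
  · let f : ℝ → ℝ := fun u => if t < u then 1 else 0
    calc _ ≤ ∑ i ∈ Finset.range P.N, P.mesh * (f (P.t (i + 1)) - f (P.t i)) := by
          refine Finset.sum_le_sum fun i hi => ?_
          have hi := Finset.mem_range.1 hi
          have hlt := P.t_lt i hi
          have hl := P.length_pos hi
          by_cases h1 : P.t (i + 1) ≤ t
          · have : P.overlap i t = P.t (i + 1) - P.t i := by
              rw [overlap, min_eq_left h1, min_eq_left (hlt.le.trans h1)]
            rw [this, div_self hl.ne']
            simp [f, not_lt.2 h1, not_lt.2 (hlt.le.trans h1)]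
          · by_cases h2 : t < P.t i
            · have : P.overlap i s = 0 := by
                rw [overlap, min_eq_right (by linarith), min_eq_right (by linarith), sub_self]
              simp [this, f, h2, h2.trans hlt]
            · simp only [f, if_pos (not_le.1 h1), if_neg h2, sub_zero, mul_one]
              have h3 : 1 - P.overlap i t / (P.t (i + 1) - P.t i) ≤ 1 := by
                linarith [div_nonneg (P.overlap_nonneg hi t) hl.le]
              calc _ ≤ P.overlap i s * 1 := mul_le_mul_of_nonneg_left h3 (P.overlap_nonneg hi s)
                _ ≤ P.mesh := by
                  rw [mul_one]; exact (P.overlap_le hi s).trans (P.length_le_mesh hi)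
      _ = P.mesh * (f 1 - f 0) := by rw [← Finset.mul_sum, P.sum_sub]
      _ ≤ P.mesh * 1 := by
          refine mul_le_mul_of_nonneg_left ?_ P.mesh_pos.le
          simp only [f]
          split_ifs <;> norm_num
      _ = P.mesh := mul_one _

end UnitPartition

/-! ### Indexing between consecutive levels of a refining sequence. -/

namespace PartitionSeq

variable {π : PartitionSeq}

theorem t_zero_one (π : PartitionSeq) : π.t 0 1 = 1 := by
  have := (π.part 0).t_last
  rwa [π.part_zero] at this

theorem Refining.subset (h : π.Refining) (n : ℕ) :
    (π.part n).points ⊆ (π.part (n + 1)).points := by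
  rcases Nat.eq_zero_or_pos n with rfl | hn
  · intro s hs
    obtain ⟨i, hi, rfl⟩ := (UnitPartition.mem_points _).1 hs
    rw [π.part_zero] at hi
    rw [UnitPartition.mem_points]
    interval_cases i
    · exact ⟨0, Nat.zero_le _, by rw [UnitPartition.t_zero, UnitPartition.t_zero]⟩
    · exact ⟨_, le_rfl, by rw [UnitPartition.t_last]; exact π.t_zero_one.symm⟩
  · exact h n hn

/-- Since t^m_k is itself a point of level m + 1, the infimum is attained with equality. Comparison
with its index there keeps `p` in range, although `t` is unconstrained beyond `N`. -/
theorem Refining.t_p (h : π.Refining) {m k : ℕ} (hk : k ≤ π.N m) :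
    π.p m k ≤ π.N (m + 1) ∧ π.t (m + 1) (π.p m k) = π.t m k := by
  obtain ⟨j, hj, hjk⟩ := (UnitPartition.mem_points _).1
    (h.subset m ((UnitPartition.mem_points _).2 ⟨k, hk, rfl⟩))
  have hmem : j ∈ {j : ℕ | π.t m k ≤ π.t (m + 1) j} := hjk.ge
  have hp : π.p m k ≤ j := Nat.sInf_le hmem
  have hp' : π.t m k ≤ π.t (m + 1) (π.p m k) := Nat.sInf_mem ⟨j, hmem⟩
  exact ⟨hp.trans hj, le_antisymm ((UnitPartition.t_mono _ hp hj).trans hjk.le) hp'⟩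

theorem Refining.p_lt_p_succ (h : π.Refining) {m k : ℕ} (hk : k < π.N m) :
    π.p m k < π.p m (k + 1) := by
  refine UnitPartition.lt_of_t_lt (π.part (m + 1)) (h.t_p hk.le).1 ?_
  change π.t (m + 1) _ < π.t (m + 1) _
  rw [(h.t_p hk.le).2, (h.t_p hk).2]
  exact (π.part m).t_lt k hk

theorem p_zero (π : PartitionSeq) (m : ℕ) : π.p m 0 = 0 := by
  refine Nat.sInf_eq_zero.2 (Or.inl ?_)
  change (π.part m).t 0 ≤ (π.part (m + 1)).t 0
  rw [UnitPartition.t_zero, UnitPartition.t_zero]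

theorem Refining.p_last (h : π.Refining) (m : ℕ) : π.p m (π.N m) = π.N (m + 1) := by
  refine UnitPartition.t_injOn (π.part (m + 1)) (h.t_p le_rfl).1 le_rfl ?_
  rw [UnitPartition.t_last]
  exact (h.t_p le_rfl).2.trans (UnitPartition.t_last _)

/-- Grouping the intervals of `π^{m+1}` according to the interval of `π^m` that contains them. -/
theorem Refining.sum_sum_p (h : π.Refining) (m : ℕ) (f : ℕ → ℝ) :
    ∑ k ∈ Finset.range (π.N m), ∑ j ∈ Finset.range (π.p m (k + 1) - π.p m k), f (π.p m k + j) =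
      ∑ j ∈ Finset.range (π.N (m + 1)), f j := by
  have key : ∀ K ≤ π.N m, ∑ k ∈ Finset.range K,
      ∑ j ∈ Finset.range (π.p m (k + 1) - π.p m k), f (π.p m k + j) =
      ∑ j ∈ Finset.range (π.p m K), f j := by
    intro K hK
    induction K with
    | zero => simp [p_zero]
    | succ K ih =>
      rw [Finset.sum_range_succ, ih (by omega), ← Finset.sum_range_add,
        Nat.add_sub_cancel' (h.p_lt_p_succ hK).le]
  rw [key _ le_rfl, h.p_last]

end PartitionSeq

/-! ### Explicit Schauder functions and the telescoping of covariance kernels. -/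

theorem intervalIntegral_indicator_Ico (c : ℝ) {a b s : ℝ} (ha : 0 ≤ a) (hab : a ≤ b)
    (hs : 0 ≤ s) :
    ∫ u in (0 : ℝ)..s, (Ico a b).indicator (fun _ => c) u = c * (min b s - min a s) := by
  rw [intervalIntegral.integral_of_le hs, integral_indicator measurableSet_Ico,
    Measure.restrict_restrict measurableSet_Ico,
    Measure.restrict_congr_set (t := Ioc a b ∩ Ioc 0 s) (Ico_ae_eq_Ioc.inter (ae_eq_refl _)),
    setIntegral_const, Ioc_inter_Ioc, Real.volume_real_Ioc, sup_eq_left.2 ha, smul_eq_mul, mul_comm]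
  congr 1
  change max (min b s - a) 0 = _
  rcases min_cases b s with h1 | h1 <;> rcases min_cases a s with h2 | h2 <;>
  rcases max_cases (min b s - a) 0 with h3 | h3 <;> linarith

namespace PartitionSeq

variable {π : PartitionSeq}

theorem schauder_eq {m k i : ℕ} (hi : 1 ≤ i) (hN : π.p m k + i ≤ π.N (m + 1)) {s : ℝ}
    (hs : 0 ≤ s) :
    π.schauder m k i s =
      Real.sqrt ((π.t (m + 1) (π.p m k + i) - π.t (m + 1) (π.p m k + i - 1)) /
        (π.t (m + 1) (π.p m k + i - 1) - π.t (m + 1) (π.p m k)) *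
        (1 / (π.t (m + 1) (π.p m k + i) - π.t (m + 1) (π.p m k)))) *
        (min (π.t (m + 1) (π.p m k + i - 1)) s - min (π.t (m + 1) (π.p m k)) s) -
      Real.sqrt ((π.t (m + 1) (π.p m k + i - 1) - π.t (m + 1) (π.p m k)) /
        (π.t (m + 1) (π.p m k + i) - π.t (m + 1) (π.p m k + i - 1)) *
        (1 / (π.t (m + 1) (π.p m k + i) - π.t (m + 1) (π.p m k)))) *
        (min (π.t (m + 1) (π.p m k + i)) s - min (π.t (m + 1) (π.p m k + i - 1)) s) := by
  have hN' : π.p m k + i ≤ (π.part (m + 1)).N := hN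
  have h12 : π.t (m + 1) (π.p m k) ≤ π.t (m + 1) (π.p m k + i - 1) :=
    UnitPartition.t_mono _ (by omega) (by omega)
  have h23 : π.t (m + 1) (π.p m k + i - 1) ≤ π.t (m + 1) (π.p m k + i) :=
    UnitPartition.t_mono _ (by omega) (by omega)
  have h0 : 0 ≤ π.t (m + 1) (π.p m k) := UnitPartition.t_nonneg _ (by omega)
  have hint : ∀ c a b : ℝ, IntervalIntegrable ((Ico a b).indicator fun _ => c) volume 0 s :=
    fun c a b => by
      rw [intervalIntegrable_iff]
      exact (integrableOn_const (by simp)).indicator measurableSet_Ico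
  rw [sub_eq_add_neg, ← neg_mul, ← intervalIntegral_indicator_Ico _ h0 h12 hs,
    ← intervalIntegral_indicator_Ico _ (h0.trans h12) h23 hs,
    ← intervalIntegral.integral_add (hint _ _ _) (hint _ _ _), schauder]
  congr 1
  funext u
  simp only [haar, indicator_apply, mem_Ico]
  by_cases hu : π.t (m + 1) (π.p m k) ≤ u ∧ u < π.t (m + 1) (π.p m k + i - 1)
  · rw [if_pos hu, if_pos hu, if_neg (fun h => absurd h.1 (not_le.2 hu.2)), add_zero]
  · rw [if_neg hu, if_neg hu, zero_add]

/-- The first two terms on the right are the projection onto the indicators of two adjacent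
intervals of lengths a and b, the last one the projection onto the indicator of their union. The
difference has rank one and is carried by the Haar function. -/
theorem haar_coeff_mul {a b : ℝ} (ha : 0 < a) (hb : 0 < b) (A B A' B' : ℝ) :
    (√(b / a * (1 / (a + b))) * A - √(a / b * (1 / (a + b))) * B) *
      (√(b / a * (1 / (a + b))) * A' - √(a / b * (1 / (a + b))) * B') =
    A * A' / a + B * B' / b - (A + B) * (A' + B') / (a + b) := by
  have h1 : √(b / a * (1 / (a + b))) * √(b / a * (1 / (a + b))) = b / a * (1 / (a + b)) :=
    Real.mul_self_sqrt (by positivity)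
  have h2 : √(a / b * (1 / (a + b))) * √(a / b * (1 / (a + b))) = a / b * (1 / (a + b)) :=
    Real.mul_self_sqrt (by positivity)
  have h3 : √(b / a * (1 / (a + b))) * √(a / b * (1 / (a + b))) = 1 / (a + b) := by
    rw [← Real.sqrt_mul (by positivity)]
    rw [show b / a * (1 / (a + b)) * (a / b * (1 / (a + b))) = (1 / (a + b)) ^ 2 by
      field_simp]
    exact Real.sqrt_sq (by positivity)
  set α := √(b / a * (1 / (a + b)))
  set β := √(a / b * (1 / (a + b)))
  have : (α * A - β * B) * (α * A' - β * B') =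
      (α * α) * (A * A') + (β * β) * (B * B') - (α * β) * (A * B' + B * A') := by ring
  rw [this, h1, h2, h3]
  field_simp
  ring

/-- The Schauder functions supported on one interval of `π^m` reproduce the difference of the
covariance kernels of levels `m + 1` and `m` on that interval. -/
theorem sum_branch_schauder_mul {m k L : ℕ} (hL : 1 ≤ L) (hN : π.p m k + L ≤ π.N (m + 1))
    {s t : ℝ} (hs : 0 ≤ s) (ht : 0 ≤ t) :
    ∑ i ∈ Finset.Icc 2 L, π.schauder m k i s * π.schauder m k i t =
      ∑ j ∈ Finset.range L, (π.part (m + 1)).overlap (π.p m k + j) s *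
        (π.part (m + 1)).overlap (π.p m k + j) t /
        (π.t (m + 1) (π.p m k + j + 1) - π.t (m + 1) (π.p m k + j)) -
      (min (π.t (m + 1) (π.p m k + L)) s - min (π.t (m + 1) (π.p m k)) s) *
      (min (π.t (m + 1) (π.p m k + L)) t - min (π.t (m + 1) (π.p m k)) t) /
      (π.t (m + 1) (π.p m k + L) - π.t (m + 1) (π.p m k)) := by
  -- The function with i = L + 1 splits a block of L + 1 intervals into its first L and the last
  -- one. By `haar_coeff_mul` the term of the old block cancels.
  induction L, hL using Nat.le_induction with
  | base => simp [UnitPartition.overlap]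
  | succ L hL ih =>
    rw [Finset.sum_Icc_succ_top (by omega), ih (by omega), Finset.sum_range_succ,
      schauder_eq (by omega) hN hs, schauder_eq (by omega) hN ht]
    have e1 : π.p m k + (L + 1) - 1 = π.p m k + L := by omega
    rw [e1, ← add_assoc]
    have hN' : π.p m k + (L + 1) ≤ (π.part (m + 1)).N := hN
    have h12 : 0 < π.t (m + 1) (π.p m k + L) - π.t (m + 1) (π.p m k) :=
      sub_pos.2 (UnitPartition.t_strictMono _ (by omega) (by omega))
    have h23 : 0 < π.t (m + 1) (π.p m k + L + 1) - π.t (m + 1) (π.p m k + L) :=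
      sub_pos.2 (UnitPartition.t_strictMono _ (by omega) (by omega))
    have h13 : π.t (m + 1) (π.p m k + L + 1) - π.t (m + 1) (π.p m k) =
      (π.t (m + 1) (π.p m k + L) - π.t (m + 1) (π.p m k)) +
      (π.t (m + 1) (π.p m k + L + 1) - π.t (m + 1) (π.p m k + L)) := by ring
    rw [h13, haar_coeff_mul h12 h23]
    simp only [UnitPartition.overlap]
    ring

theorem schauder_eq_zero {m k i : ℕ} (hi : 2 ≤ i) (hN : π.p m k + i ≤ π.N (m + 1)) {s : ℝ}
    (hs : 0 ≤ s) (h : s ≤ π.t (m + 1) (π.p m k) ∨ π.t (m + 1) (π.p m k + i) ≤ s) :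
    π.schauder m k i s = 0 := by
  rw [schauder_eq (by omega) hN hs]
  have hN' : π.p m k + i ≤ (π.part (m + 1)).N := hN
  have h12 : π.t (m + 1) (π.p m k) < π.t (m + 1) (π.p m k + i - 1) :=
    UnitPartition.t_strictMono _ (by omega) (by omega)
  have h23 : π.t (m + 1) (π.p m k + i - 1) < π.t (m + 1) (π.p m k + i) :=
    UnitPartition.t_strictMono _ (by omega) (by omega)
  rcases h with h | h
  · rw [min_eq_right h, min_eq_right (h.trans h12.le),
      min_eq_right (h.trans (h12.trans h23).le)]
    ring
  · rw [min_eq_left h, min_eq_left (h23.le.trans h), min_eq_left ((h12.trans h23).le.trans h)]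
    set a := π.t (m + 1) (π.p m k + i - 1) - π.t (m + 1) (π.p m k)
    set b := π.t (m + 1) (π.p m k + i) - π.t (m + 1) (π.p m k + i - 1)
    have ha : 0 < a := sub_pos.2 h12
    have hb : 0 < b := sub_pos.2 h23
    have hc : π.t (m + 1) (π.p m k + i) - π.t (m + 1) (π.p m k) = a + b := by
      simp only [a, b]; ring
    rw [hc]
    -- To the right of the support the value is the total integral of the Haar function. The product
    -- formula shows that its square is zero.
    have h0 := haar_coeff_mul ha hb a b a b
    have h1 : a * a / a + b * b / b - (a + b) * (a + b) / (a + b) = 0 := by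
      field_simp
      ring
    rw [h1] at h0
    exact mul_self_eq_zero.1 h0

/-- The Haar indices of level `m`. -/
def levelIndex (π : PartitionSeq) (m : ℕ) : Finset (ℕ × ℕ × ℕ) :=
  (Finset.range (π.N m)).biUnion fun k => (π.branchIndex m k).image fun i => (m, k, i)

/-- The Haar indices of level less than `n`. -/
def truncIndex (π : PartitionSeq) (n : ℕ) : Finset (ℕ × ℕ × ℕ) :=
  (Finset.range n).biUnion π.levelIndex

/-- The Schauder function with index `a`. -/
def schauderFn (π : PartitionSeq) (a : ℕ × ℕ × ℕ) (t : ℝ) : ℝ := π.schauder a.1 a.2.1 a.2.2 t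

theorem mem_levelIndex {m : ℕ} {a : ℕ × ℕ × ℕ} :
    a ∈ π.levelIndex m ↔ a.1 = m ∧ a ∈ π.haarIndex := by
  obtain ⟨m', k, i⟩ := a
  simp only [levelIndex, Finset.mem_biUnion, Finset.mem_range, Finset.mem_image, haarIndex,
    mem_ofPred_eq, Prod.mk.injEq]
  constructor
  · rintro ⟨k, hk, i, hi, rfl, rfl, rfl⟩
    exact ⟨rfl, hk, hi⟩
  · rintro ⟨rfl, hk, hi⟩
    exact ⟨k, hk, i, hi, rfl, rfl, rfl⟩

theorem mem_truncIndex {n : ℕ} {a : ℕ × ℕ × ℕ} :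
    a ∈ π.truncIndex n ↔ a.1 < n ∧ a ∈ π.haarIndex := by
  simp [truncIndex, mem_levelIndex]

theorem sum_levelIndex (π : PartitionSeq) (m : ℕ) (f : ℕ × ℕ × ℕ → ℝ) :
    ∑ a ∈ π.levelIndex m, f a =
      ∑ k ∈ Finset.range (π.N m), ∑ i ∈ π.branchIndex m k, f (m, k, i) := by
  rw [levelIndex, Finset.sum_biUnion]
  · refine Finset.sum_congr rfl fun k _ => Finset.sum_image fun i _ j _ h => ?_
    simpa using h
  · intro k _ k' _ hkk'
    simp only [Function.onFun, Finset.disjoint_left, Finset.mem_image]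
    rintro a ⟨i, _, rfl⟩ ⟨j, _, h⟩
    exact hkk' (by simpa using (Prod.mk.inj (Prod.mk.inj h).2).1.symm)

theorem sum_truncIndex (π : PartitionSeq) (n : ℕ) (f : ℕ × ℕ × ℕ → ℝ) :
    ∑ a ∈ π.truncIndex n, f a = ∑ m ∈ Finset.range n, ∑ a ∈ π.levelIndex m, f a := by
  rw [truncIndex, Finset.sum_biUnion]
  intro m _ m' _ h
  simp only [Function.onFun, Finset.disjoint_left, mem_levelIndex]
  rintro a ⟨rfl, _⟩ ⟨h', _⟩
  exact h h'

theorem schauderPartialSum_eq (π : PartitionSeq) (a b : ℝ) (θ : ℕ × ℕ × ℕ → ℝ) (n : ℕ) (t : ℝ) :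
    π.schauderPartialSum a b θ n t = a + b * t + ∑ c ∈ π.truncIndex n, θ c * π.schauderFn c t := by
  simp only [schauderPartialSum, sum_truncIndex, sum_levelIndex, schauderFn]

theorem Refining.sum_level_schauder_mul (h : π.Refining) (m : ℕ) {s t : ℝ} (hs : 0 ≤ s)
    (ht : 0 ≤ t) :
    ∑ a ∈ π.levelIndex m, π.schauderFn a s * π.schauderFn a t =
      (π.part (m + 1)).kernel s t - (π.part m).kernel s t := by
  rw [sum_levelIndex, UnitPartition.kernel, UnitPartition.kernel,
    ← h.sum_sum_p m (fun j => (π.part (m + 1)).overlap j s * (π.part (m + 1)).overlap j t /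
      (π.t (m + 1) (j + 1) - π.t (m + 1) j)), ← Finset.sum_sub_distrib]
  refine Finset.sum_congr rfl fun k hk => ?_
  have hk := Finset.mem_range.1 hk
  have hlt := h.p_lt_p_succ hk
  have hpk := h.t_p hk.le
  have hpk' := h.t_p (k := k + 1) hk
  have hadd : π.p m k + (π.p m (k + 1) - π.p m k) = π.p m (k + 1) := by omega
  have := sum_branch_schauder_mul (π := π) (m := m) (k := k)
    (L := π.p m (k + 1) - π.p m k) (by omega) (by omega) hs ht
  rw [hadd, hpk.2, hpk'.2] at this
  exact this

theorem kernel_zero (π : PartitionSeq) {s t : ℝ} (hs : s ∈ Icc (0 : ℝ) 1)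
    (ht : t ∈ Icc (0 : ℝ) 1) : (π.part 0).kernel s t = s * t := by
  have h0 : (π.part 0).t 0 = 0 := (π.part 0).t_zero
  have h1 : (π.part 0).t 1 = 1 := π.t_zero_one
  simp [UnitPartition.kernel, π.part_zero, UnitPartition.overlap, h0, h1, hs.1, hs.2, ht.1, ht.2]

/-- The level contributions telescope down to π^0 = {0, 1}, whose kernel is st. -/
theorem Refining.sum_trunc_schauder_mul (h : π.Refining) (n : ℕ) {s t : ℝ}
    (hs : s ∈ Icc (0 : ℝ) 1) (ht : t ∈ Icc (0 : ℝ) 1) :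
    ∑ a ∈ π.truncIndex n, π.schauderFn a s * π.schauderFn a t =
      (π.part n).kernel s t - s * t := by
  rw [sum_truncIndex, Finset.sum_congr rfl fun m _ => h.sum_level_schauder_mul m hs.1 ht.1,
    Finset.sum_range_sub (fun m => (π.part m).kernel s t), kernel_zero π hs ht]

/-- An interval with L children carries L - 1 Haar functions. -/
theorem Refining.card_levelIndex (h : π.Refining) (m : ℕ) :
    ((π.levelIndex m).card : ℝ) = π.N (m + 1) - π.N m := by
  have h1 := sum_levelIndex π m (fun _ => 1)
  have h2 := h.sum_sum_p m (fun _ => 1)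
  simp only [Finset.sum_const, nsmul_eq_mul, mul_one, Finset.card_range] at h1 h2
  rw [h1, ← h2]
  have : (π.N m : ℝ) = ∑ k ∈ Finset.range (π.N m), (1 : ℝ) := by simp
  rw [this, ← Finset.sum_sub_distrib]
  refine Finset.sum_congr rfl fun k hk => ?_
  have hlt := h.p_lt_p_succ (Finset.mem_range.1 hk)
  rw [branchIndex, Nat.card_Icc, show π.p m (k + 1) - π.p m k + 1 - 2 =
    π.p m (k + 1) - π.p m k - 1 by omega, Nat.cast_sub (by omega), Nat.cast_one]

/-- The moment factorisation requires four distinct indices, so products of fewer variables must be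
padded with spare ones. There are enough of these: finitely many indices would bound the number of
intervals while the mesh tends to 0. -/
theorem FinitelyRefining.infinite_haarIndex (h : π.FinitelyRefining) :
    π.haarIndex.Infinite := by
  intro hfin
  have hcard : ∀ n, (π.N n : ℝ) ≤ hfin.toFinset.card + 1 := by
    intro n
    have h1 : ((π.truncIndex n).card : ℝ) = π.N n - 1 := by
      have h2 := sum_truncIndex π n (fun _ => 1)
      simp only [Finset.sum_const, nsmul_eq_mul, mul_one, h.refining.card_levelIndex] at h2
      rw [h2, Finset.sum_range_sub (fun m => (π.N m : ℝ)), N, N, π.part_zero, Nat.cast_one]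
    have h2 : (π.truncIndex n).card ≤ hfin.toFinset.card :=
      Finset.card_le_card fun a ha => hfin.mem_toFinset.2 (mem_truncIndex.1 ha).2
    have h3 : ((π.truncIndex n).card : ℝ) ≤ hfin.toFinset.card := by exact_mod_cast h2
    linarith
  have hlim := (h.mesh_tendsto.const_mul ((hfin.toFinset.card : ℝ) + 1))
  rw [mul_zero] at hlim
  refine absurd (ge_of_tendsto' hlim fun n => ?_) (not_le.2 one_pos)
  exact (π.part n).one_le_N_mul_mesh.trans
    (mul_le_mul_of_nonneg_right (hcard n) (π.part n).mesh_pos.le)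

end PartitionSeq

/-! ### Variance of quadratic forms under fourth order factorisation. -/

section Moments

variable {Ω ι : Type*} [MeasurableSpace Ω] {μ : Measure Ω}

/-- A family of centred orthonormal random variables whose fourth moments are bounded by `M` and
whose moments of order four factorise. -/
structure FourthOrderIndep (μ : Measure Ω) (I : Set ι) (η : ι → Ω → ℝ) (M : ℝ) : Prop where
  memLp : ∀ a ∈ I, MemLp (η a) 4 μ
  integral_eq_zero : ∀ a ∈ I, ∫ ω, η a ω ∂μ = 0
  integral_sq : ∀ a ∈ I, ∫ ω, η a ω * η a ω ∂μ = 1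
  integral_mul : ∀ a ∈ I, ∀ b ∈ I, a ≠ b → ∫ ω, η a ω * η b ω ∂μ = 0
  integral_pow_four : ∀ a ∈ I, ∫ ω, η a ω ^ 4 ∂μ ≤ M
  integral_factor : ∀ a ∈ I, ∀ b ∈ I, ∀ c ∈ I, ∀ d ∈ I,
      [a, b, c, d].Nodup → ∀ i j k l : ℕ, i + j + k + l = 4 →
      ∫ ω, η a ω ^ i * η b ω ^ j * η c ω ^ k * η d ω ^ l ∂μ =
        (∫ ω, η a ω ^ i ∂μ) * (∫ ω, η b ω ^ j ∂μ) * (∫ ω, η c ω ^ k ∂μ) * (∫ ω, η d ω ^ l ∂μ)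

theorem MeasureTheory.MemLp.mul_four {f g : Ω → ℝ} (hf : MemLp f 4 μ) (hg : MemLp g 4 μ) :
    MemLp (fun ω => f ω * g ω) 2 μ := by
  have : ENNReal.HolderTriple 4 4 2 := ⟨by
    rw [← two_mul, show (4 : ENNReal) = 2 * 2 by norm_num,
      ENNReal.mul_inv (by norm_num) (by norm_num), ← mul_assoc,
      ENNReal.mul_inv_cancel (by norm_num) (by norm_num), one_mul]⟩
  exact hg.mul' hf

namespace FourthOrderIndep

variable {I : Set ι} {η : ι → Ω → ℝ} {M : ℝ}

/-- Once equal indices among b, c, d are merged and fresh indices are added with exponent 0, the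
expectation factorises and contains the factor E η_a = 0. -/
theorem integral_isolated [DecidableEq ι] (h : FourthOrderIndep μ I η M) (hI : I.Infinite)
    {a b c d : ι} (ha : a ∈ I) (hb : b ∈ I) (hc : c ∈ I) (hd : d ∈ I) (hab : a ≠ b) (hac : a ≠ c)
    (had : a ≠ d) :
    ∫ ω, η a ω * η b ω * (η c ω * η d ω) ∂μ = 0 := by
  have h0 : ∫ ω, η a ω ^ 1 ∂μ = 0 := by simpa using h.integral_eq_zero a ha
  obtain ⟨e, he, hne⟩ := hI.exists_notMem_finset {a, b, c, d}
  obtain ⟨f, hf, hnf⟩ := hI.exists_notMem_finset {a, b, c, d, e}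
  simp only [Finset.mem_insert, Finset.mem_singleton, not_or] at hne hnf
  have key : ∀ b' ∈ I, ∀ c' ∈ I, ∀ d' ∈ I, [a, b', c', d'].Nodup → ∀ j k l : ℕ, j + k + l = 3 →
      ∫ ω, η a ω ^ 1 * η b' ω ^ j * η c' ω ^ k * η d' ω ^ l ∂μ = 0 := by
    intro b' hb' c' hc' d' hd' hnd j k l hjkl
    rw [h.integral_factor a ha b' hb' c' hc' d' hd' hnd 1 j k l (by omega), h0]
    ring
  by_cases hbc : b = c
  · subst hbc
    by_cases hbd : b = d
    · subst hbd
      rw [← key b hb e he f hf (by simp; grind) 3 0 0 rfl]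
      exact integral_congr_ae (.of_forall fun ω => by ring)
    · rw [← key b hb d hd e he (by simp; grind) 2 1 0 rfl]
      exact integral_congr_ae (.of_forall fun ω => by ring)
  · by_cases hbd : b = d
    · subst hbd
      rw [← key b hb c hc e he (by simp; grind) 2 1 0 rfl]
      exact integral_congr_ae (.of_forall fun ω => by ring)
    · by_cases hcd : c = d
      · subst hcd
        rw [← key b hb c hc e he (by simp; grind) 1 2 0 rfl]
        exact integral_congr_ae (.of_forall fun ω => by ring)
      · rw [← key b hb c hc d hd (by simp; grind) 1 1 1 rfl]
        exact integral_congr_ae (.of_forall fun ω => by ring)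

theorem integral_sq_mul_sq [DecidableEq ι] [IsProbabilityMeasure μ]
    (h : FourthOrderIndep μ I η M) (hI : I.Infinite)
    {a b : ι} (ha : a ∈ I) (hb : b ∈ I) (hab : a ≠ b) :
    ∫ ω, η a ω * η a ω * (η b ω * η b ω) ∂μ = 1 := by
  obtain ⟨e, he, hne⟩ := hI.exists_notMem_finset {a, b}
  obtain ⟨f, hf, hnf⟩ := hI.exists_notMem_finset {a, b, e}
  simp only [Finset.mem_insert, Finset.mem_singleton, not_or] at hne hnf
  have h1 := h.integral_factor a ha b hb e he f hf (by simp; grind) 2 2 0 0 rfl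
  simp only [pow_zero, mul_one, integral_const, probReal_univ, smul_eq_mul] at h1
  simp only [pow_two] at h1
  rw [h.integral_sq a ha, h.integral_sq b hb] at h1
  rw [h1, mul_one]

/-- The centred product `η_a η_b - E[η_a η_b]`. -/
def centredMul [DecidableEq ι] (η : ι → Ω → ℝ) (p : ι × ι) (ω : Ω) : ℝ :=
  η p.1 ω * η p.2 ω - if p.1 = p.2 then 1 else 0

variable [DecidableEq ι] [IsProbabilityMeasure μ]

theorem memLp_centredMul (h : FourthOrderIndep μ I η M) {p : ι × ι} (h1 : p.1 ∈ I) (h2 : p.2 ∈ I) :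
    MemLp (centredMul η p) 2 μ :=
  ((h.memLp _ h1).mul_four (h.memLp _ h2)).sub (memLp_const _)

theorem integral_centredMul_mul (h : FourthOrderIndep μ I η M) {p q : ι × ι}
    (hp1 : p.1 ∈ I) (hp2 : p.2 ∈ I) (hq1 : q.1 ∈ I) (hq2 : q.2 ∈ I) :
    ∫ ω, centredMul η p ω * centredMul η q ω ∂μ =
      ∫ ω, η p.1 ω * η p.2 ω * (η q.1 ω * η q.2 ω) ∂μ -
        (if p.1 = p.2 then 1 else 0) * (if q.1 = q.2 then 1 else 0) := by
  have hP := (h.memLp _ hp1).mul_four (h.memLp _ hp2)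
  have hQ := (h.memLp _ hq1).mul_four (h.memLp _ hq2)
  have iP : ∫ ω, η p.1 ω * η p.2 ω ∂μ = if p.1 = p.2 then 1 else 0 := by
    split_ifs with e
    · rw [← e, h.integral_sq _ hp1]
    · exact h.integral_mul _ hp1 _ hp2 e
  have iQ : ∫ ω, η q.1 ω * η q.2 ω ∂μ = if q.1 = q.2 then 1 else 0 := by
    split_ifs with e
    · rw [← e, h.integral_sq _ hq1]
    · exact h.integral_mul _ hq1 _ hq2 e
  set δ : ℝ := if p.1 = p.2 then 1 else 0
  set ε : ℝ := if q.1 = q.2 then 1 else 0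
  have hP1 := hP.integrable (by norm_num)
  have hQ1 := hQ.integrable (by norm_num)
  have hPQ : Integrable (fun ω => η p.1 ω * η p.2 ω * (η q.1 ω * η q.2 ω)) μ :=
    hP.integrable_mul hQ
  calc _ = ∫ ω, (η p.1 ω * η p.2 ω * (η q.1 ω * η q.2 ω) - ε * (η p.1 ω * η p.2 ω)
        - (δ * (η q.1 ω * η q.2 ω) - δ * ε)) ∂μ :=
        integral_congr_ae (.of_forall fun ω => by
          change (η p.1 ω * η p.2 ω - δ) * (η q.1 ω * η q.2 ω - ε) = _
          ring)
    _ = _ := by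
        have i1 : Integrable (fun ω => η p.1 ω * η p.2 ω * (η q.1 ω * η q.2 ω) -
            ε * (η p.1 ω * η p.2 ω)) μ := hPQ.sub (hP1.const_mul ε)
        have i2 : Integrable (fun ω => δ * (η q.1 ω * η q.2 ω) - δ * ε) μ :=
          (hQ1.const_mul δ).sub (integrable_const _)
        rw [integral_sub i1 i2, integral_sub hPQ (hP1.const_mul ε),
          integral_sub (hQ1.const_mul δ) (integrable_const _),
          integral_const_mul, integral_const_mul, iP, iQ]
        simp [mul_comm ε δ]

/-- If the pairs differ even up to order, either both are diagonal, and the moment 1 cancels the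
product of the means, or some index occurs exactly once and `integral_isolated` applies. -/
theorem integral_centredMul_mul_eq_zero (h : FourthOrderIndep μ I η M) (hI : I.Infinite)
    {p q : ι × ι} (hp1 : p.1 ∈ I) (hp2 : p.2 ∈ I) (hq1 : q.1 ∈ I) (hq2 : q.2 ∈ I)
    (hne : q ≠ p) (hne' : q ≠ p.swap) :
    ∫ ω, centredMul η p ω * centredMul η q ω ∂μ = 0 := by
  rw [h.integral_centredMul_mul hp1 hp2 hq1 hq2]
  obtain ⟨a, b⟩ := p
  obtain ⟨c, d⟩ := q
  simp only [ne_eq, Prod.mk.injEq, Prod.swap_prod_mk, not_and] at *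
  have swap1 : ∫ ω, η a ω * η b ω * (η c ω * η d ω) ∂μ =
      ∫ ω, η b ω * η a ω * (η c ω * η d ω) ∂μ :=
    integral_congr_ae (.of_forall fun ω => by ring)
  have swap2 : ∫ ω, η a ω * η b ω * (η c ω * η d ω) ∂μ =
      ∫ ω, η c ω * η d ω * (η a ω * η b ω) ∂μ :=
    integral_congr_ae (.of_forall fun ω => by ring)
  have swap3 : ∫ ω, η a ω * η b ω * (η c ω * η d ω) ∂μ =
      ∫ ω, η d ω * η c ω * (η a ω * η b ω) ∂μ :=
    integral_congr_ae (.of_forall fun ω => by ring)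
  by_cases hab : a = b
  · by_cases hcd : c = d
    · subst hab hcd
      rw [h.integral_sq_mul_sq hI hp1 hq1 (by grind)]
      simp
    · rw [if_neg hcd, mul_zero, sub_zero]
      by_cases hca : c = a
      · rw [swap3]
        exact h.integral_isolated hI hq2 hq1 hp1 hp2 (by grind) (by grind) (by grind)
      · rw [swap2]
        exact h.integral_isolated hI hq1 hq2 hp1 hp2 (by grind) (by grind) (by grind)
  · rw [if_neg hab, zero_mul, sub_zero]
    by_cases hac : a = c ∨ a = d
    · rw [swap1]
      exact h.integral_isolated hI hp2 hp1 hq1 hq2 (by grind) (by grind) (by grind)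
    · exact h.integral_isolated hI hp1 hp2 hq1 hq2 (by grind) (by grind) (by grind)

theorem integral_centredMul_sq_le (h : FourthOrderIndep μ I η M) (hI : I.Infinite)
    {p : ι × ι} (hp1 : p.1 ∈ I) (hp2 : p.2 ∈ I) :
    ∫ ω, centredMul η p ω * centredMul η p ω ∂μ ≤ max M 1 := by
  rw [h.integral_centredMul_mul hp1 hp2 hp1 hp2]
  have h0 : (0 : ℝ) ≤ (if p.1 = p.2 then 1 else 0) * (if p.1 = p.2 then 1 else 0) :=
    mul_self_nonneg _
  suffices hs : ∫ ω, η p.1 ω * η p.2 ω * (η p.1 ω * η p.2 ω) ∂μ ≤ max M 1 by linarith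
  by_cases e : p.1 = p.2
  · rw [← e]
    refine (le_of_eq ?_).trans ((h.integral_pow_four _ hp1).trans (le_max_left _ _))
    exact integral_congr_ae (.of_forall fun ω => by ring)
  · refine (le_of_eq ?_).trans (le_max_right _ _)
    rw [← h.integral_sq_mul_sq hI hp1 hp2 e]
    exact integral_congr_ae (.of_forall fun ω => by ring)

/-- The variance of a quadratic form in the `η_a` is controlled by the Frobenius norm of its
matrix. -/
theorem integral_sq_sum_centredMul_le (h : FourthOrderIndep μ I η M) (hI : I.Infinite)
    {s : Finset ι} (hs : ∀ a ∈ s, a ∈ I) {g : ι × ι → ℝ} (hg : ∀ p, g p.swap = g p) :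
    ∫ ω, (∑ p ∈ s ×ˢ s, g p * centredMul η p ω) ^ 2 ∂μ ≤
      2 * max M 1 * ∑ p ∈ s ×ˢ s, g p ^ 2 := by
  have hmem : ∀ p ∈ s ×ˢ s, p.1 ∈ I ∧ p.2 ∈ I := fun p hp =>
    ⟨hs _ (Finset.mem_product.1 hp).1, hs _ (Finset.mem_product.1 hp).2⟩
  have hL : ∀ p ∈ s ×ˢ s, MemLp (centredMul η p) 2 μ := fun p hp =>
    h.memLp_centredMul (hmem p hp).1 (hmem p hp).2
  have hint : ∀ p ∈ s ×ˢ s, ∀ q ∈ s ×ˢ s,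
      Integrable (fun ω => g p * g q * (centredMul η p ω * centredMul η q ω)) μ :=
    fun p hp q hq => ((hL p hp).integrable_mul (hL q hq)).const_mul _
  have hexp : ∫ ω, (∑ p ∈ s ×ˢ s, g p * centredMul η p ω) ^ 2 ∂μ =
      ∑ p ∈ s ×ˢ s, ∑ q ∈ s ×ˢ s, g p * g q * ∫ ω, centredMul η p ω * centredMul η q ω ∂μ := by
    simp_rw [← integral_const_mul]
    rw [Finset.sum_congr rfl fun p hp => (integral_finsetSum _ (hint p hp)).symm,
      ← integral_finsetSum _ fun p hp => integrable_finsetSum _ (hint p hp)]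
    refine integral_congr_ae (.of_forall fun ω => ?_)
    simp only [pow_two, Finset.sum_mul_sum]
    exact Finset.sum_congr rfl fun p _ => Finset.sum_congr rfl fun q _ => by ring
  rw [hexp, Finset.mul_sum]
  refine Finset.sum_le_sum fun p hp => ?_
  have hsw : p.swap ∈ s ×ˢ s := by
    rw [Finset.mem_product] at hp ⊢
    exact ⟨hp.2, hp.1⟩
  have hM : 0 ≤ max M 1 * g p ^ 2 := mul_nonneg (zero_le_one.trans (le_max_right _ _)) (sq_nonneg _)
  have hpp := h.integral_centredMul_sq_le hI (hmem p hp).1 (hmem p hp).2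
  -- In row p of the covariance matrix only q = p and q = `p.swap` survive. For a diagonal p these
  -- coincide and the bound is merely doubled.
  calc _ ≤ ∑ q ∈ s ×ˢ s, ((if q = p then max M 1 * g p ^ 2 else 0) +
        (if q = p.swap then max M 1 * g p ^ 2 else 0)) := by
        refine Finset.sum_le_sum fun q hq => ?_
        by_cases h1 : q = p
        · subst h1
          rw [if_pos rfl]
          have : g q * g q * ∫ ω, centredMul η q ω * centredMul η q ω ∂μ ≤
              max M 1 * g q ^ 2 := by
            nlinarith [mul_le_mul_of_nonneg_left hpp (sq_nonneg (g q))]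
          split_ifs <;> linarith
        · by_cases h2 : q = p.swap
          · subst h2
            rw [if_pos rfl, if_neg h1, hg, zero_add]
            have e : centredMul η p.swap = centredMul η p := by
              funext ω
              simp only [centredMul, Prod.fst_swap, Prod.snd_swap, mul_comm, eq_comm]
            rw [e]
            nlinarith [mul_le_mul_of_nonneg_left hpp (sq_nonneg (g p))]
          · rw [if_neg h1, if_neg h2, h.integral_centredMul_mul_eq_zero hI (hmem p hp).1
              (hmem p hp).2 (hmem q hq).1 (hmem q hq).2 h1 h2]
            simp
    _ = 2 * max M 1 * g p ^ 2 := by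
        rw [Finset.sum_add_distrib, Finset.sum_ite_eq', Finset.sum_ite_eq', if_pos hp, if_pos hsw]
        ring

end FourthOrderIndep

end Moments

/-! ### Frobenius bounds for Gram matrices of increments. -/

theorem sum_product_sq_sum_mul {α β : Type*} (s : Finset α) (r : Finset β) (c : α → β → ℝ) :
    ∑ p ∈ s ×ˢ s, (∑ i ∈ r, c p.1 i * c p.2 i) ^ 2 =
      ∑ i ∈ r, ∑ j ∈ r, (∑ a ∈ s, c a i * c a j) ^ 2 := by
  -- For the matrix C = (c a i), this is the equality of the Frobenius norms of CCᵀ and CᵀC: both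
  -- squares expand to the same fourfold sum.
  have h1 : ∀ p : α × α, (∑ i ∈ r, c p.1 i * c p.2 i) ^ 2 =
      ∑ i ∈ r, ∑ j ∈ r, (c p.1 i * c p.1 j) * (c p.2 i * c p.2 j) := fun p => by
    rw [pow_two, Finset.sum_mul_sum]
    exact Finset.sum_congr rfl fun i _ => Finset.sum_congr rfl fun j _ => by ring
  simp_rw [h1]
  rw [Finset.sum_comm]
  refine Finset.sum_congr rfl fun i _ => ?_
  rw [Finset.sum_comm]
  refine Finset.sum_congr rfl fun j _ => ?_
  rw [pow_two, Finset.sum_mul_sum, Finset.sum_product]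

/-- Frobenius bound for the Gram matrix of the projections of the indicator functions of disjoint
intervals of length at most `δ`. -/
theorem sum_sq_gram_le {α β : Type*} (J : Finset α) (r : Finset β) {H : α → β → ℝ} {l : α → ℝ}
    {v : β → ℝ} {δ : ℝ} (hδ : 0 ≤ δ) (hH : ∀ k ∈ J, ∀ i ∈ r, 0 ≤ H k i) (hl : ∀ k ∈ J, 0 < l k)
    (hHl : ∀ k ∈ J, ∑ i ∈ r, H k i ≤ l k) (hHv : ∀ i ∈ r, ∑ k ∈ J, H k i = v i)
    (hv : ∀ i ∈ r, v i ≤ δ) (hv1 : ∑ i ∈ r, v i ≤ 1) :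
    ∑ i ∈ r, ∑ j ∈ r, (∑ k ∈ J, H k i * H k j / l k - v i * v j) ^ 2 ≤ 2 * δ := by
  have hv0 : ∀ i ∈ r, 0 ≤ v i := fun i hi => by
    rw [← hHv i hi]; exact Finset.sum_nonneg fun k hk => hH k hk i hi
  have hvle : ∀ i ∈ r, v i ≤ 1 := fun i hi => (Finset.single_le_sum hv0 hi).trans hv1
  have hw0 : ∀ i ∈ r, ∀ j ∈ r, 0 ≤ ∑ k ∈ J, H k i * H k j / l k := fun i hi j hj =>
    Finset.sum_nonneg fun k hk => div_nonneg (mul_nonneg (hH k hk i hi) (hH k hk j hj)) (hl k hk).le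
  have hwδ : ∀ i ∈ r, ∀ j ∈ r, ∑ k ∈ J, H k i * H k j / l k ≤ δ := fun i hi j hj => by
    refine le_trans ?_ (hv i hi)
    rw [← hHv i hi]
    refine Finset.sum_le_sum fun k hk => ?_
    rw [div_le_iff₀ (hl k hk)]
    exact mul_le_mul_of_nonneg_left ((Finset.single_le_sum (f := fun j => H k j)
      (fun i hi => hH k hk i hi) hj).trans (hHl k hk)) (hH k hk i hi)
  have hwsum : ∀ i ∈ r, ∑ j ∈ r, ∑ k ∈ J, H k i * H k j / l k ≤ v i := fun i hi => by
    rw [Finset.sum_comm, ← hHv i hi]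
    refine Finset.sum_le_sum fun k hk => ?_
    rw [← Finset.sum_div, ← Finset.mul_sum, div_le_iff₀ (hl k hk)]
    exact mul_le_mul_of_nonneg_left (hHl k hk) (hH k hk i hi)
  -- Both w = ∑ H H / l and u = v v lie in [0, δ], so (w - u)² ≤ w² + u² ≤ δ(w + u). Each of w and u
  -- has total sum at most 1.
  calc _ ≤ ∑ i ∈ r, ∑ j ∈ r, (δ * (∑ k ∈ J, H k i * H k j / l k) + δ * (v i * v j)) := by
        refine Finset.sum_le_sum fun i hi => Finset.sum_le_sum fun j hj => ?_
        have h1 := hw0 i hi j hj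
        have h2 := hwδ i hi j hj
        have h3 : 0 ≤ v i * v j := mul_nonneg (hv0 i hi) (hv0 j hj)
        have h4 : v i * v j ≤ δ := by
          nlinarith [hv i hi, hvle j hj, hv0 i hi, hv0 j hj]
        set w := ∑ k ∈ J, H k i * H k j / l k
        nlinarith [mul_nonneg h1 h3, mul_nonneg h1 (sub_nonneg.2 h2),
          mul_nonneg h3 (sub_nonneg.2 h4)]
    _ = δ * ∑ i ∈ r, ∑ j ∈ r, ∑ k ∈ J, H k i * H k j / l k +
          δ * ((∑ i ∈ r, v i) * ∑ i ∈ r, v i) := by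
        simp_rw [Finset.sum_add_distrib, ← Finset.mul_sum, Finset.sum_mul]
    _ ≤ δ * 1 + δ * (1 * 1) := by
        have h0 := Finset.sum_nonneg hv0
        refine add_le_add (mul_le_mul_of_nonneg_left ?_ hδ) (mul_le_mul_of_nonneg_left ?_ hδ)
        · exact (Finset.sum_le_sum hwsum).trans hv1
        · exact mul_le_mul hv1 hv1 h0 zero_le_one
    _ = 2 * δ := by ring

namespace UnitPartition

variable (P : UnitPartition)

/-- The increment of `f` over the `i`-th interval of `P`, stopped at `t`. -/
def incr (f : ℝ → ℝ) (t : ℝ) (i : ℕ) : ℝ := f (min (P.t (i + 1)) t) - f (min (P.t i) t)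

theorem qv_eq (f : ℝ → ℝ) (t : ℝ) : P.qv f t = ∑ i ∈ Finset.range P.N, P.incr f t i ^ 2 := rfl

theorem min_mem {t : ℝ} (ht : t ∈ Icc (0 : ℝ) 1) {i : ℕ} (hi : i ≤ P.N) :
    min (P.t i) t ∈ Icc (0 : ℝ) 1 :=
  ⟨le_min (P.t_nonneg hi) ht.1, (min_le_right _ _).trans ht.2⟩

theorem sum_incr (f : ℝ → ℝ) {t : ℝ} (ht : t ∈ Icc (0 : ℝ) 1) :
    ∑ i ∈ Finset.range P.N, P.incr f t i = f t - f 0 := by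
  have := P.sum_sub (fun u => f (min u t))
  simp only [min_eq_right ht.2, min_eq_left ht.1] at this
  exact this

theorem sum_overlap_sq_le {t : ℝ} (ht : t ∈ Icc (0 : ℝ) 1) :
    ∑ i ∈ Finset.range P.N, P.overlap i t ^ 2 ≤ P.mesh := by
  calc _ ≤ ∑ i ∈ Finset.range P.N, P.mesh * P.overlap i t := by
        refine Finset.sum_le_sum fun i hi => ?_
        have hi := Finset.mem_range.1 hi
        rw [pow_two]
        exact mul_le_mul_of_nonneg_right ((P.overlap_le hi t).trans (P.length_le_mesh hi))
          (P.overlap_nonneg hi t)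
    _ = P.mesh * t := by rw [← Finset.mul_sum, P.sum_overlap ht]
    _ ≤ P.mesh := mul_le_of_le_one_right P.mesh_pos.le ht.2

end UnitPartition

namespace PartitionSeq

variable {π : PartitionSeq}

theorem Refining.gram_eq (h : π.Refining) (n : ℕ) (P : UnitPartition) {t : ℝ}
    (ht : t ∈ Icc (0 : ℝ) 1) {i j : ℕ} (hi : i < P.N) (hj : j < P.N) :
    ∑ a ∈ π.truncIndex n, P.incr (π.schauderFn a) t i * P.incr (π.schauderFn a) t j =
      ∑ k ∈ Finset.range (π.N n), P.incr ((π.part n).overlap k) t i *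
        P.incr ((π.part n).overlap k) t j / (π.t n (k + 1) - π.t n k) -
        P.overlap i t * P.overlap j t := by
  have mi := P.min_mem ht hi.le
  have mi' := P.min_mem ht (i := i + 1) hi
  have mj := P.min_mem ht hj.le
  have mj' := P.min_mem ht (i := j + 1) hj
  have e : ∀ f : (ℕ × ℕ × ℕ) → ℝ → ℝ, ∀ s : Finset (ℕ × ℕ × ℕ),
      ∑ a ∈ s, P.incr (f a) t i * P.incr (f a) t j =
      ∑ a ∈ s, f a (min (P.t (i + 1)) t) * f a (min (P.t (j + 1)) t) -
      ∑ a ∈ s, f a (min (P.t (i + 1)) t) * f a (min (P.t j) t) -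
      ∑ a ∈ s, f a (min (P.t i) t) * f a (min (P.t (j + 1)) t) +
      ∑ a ∈ s, f a (min (P.t i) t) * f a (min (P.t j) t) := fun f s => by
    rw [← Finset.sum_sub_distrib, ← Finset.sum_sub_distrib, ← Finset.sum_add_distrib]
    exact Finset.sum_congr rfl fun a _ => by simp only [UnitPartition.incr]; ring
  rw [e, h.sum_trunc_schauder_mul n mi' mj', h.sum_trunc_schauder_mul n mi' mj,
    h.sum_trunc_schauder_mul n mi mj', h.sum_trunc_schauder_mul n mi mj]
  have e2 : ∑ k ∈ Finset.range (π.N n), P.incr ((π.part n).overlap k) t i *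
        P.incr ((π.part n).overlap k) t j / (π.t n (k + 1) - π.t n k) =
      (π.part n).kernel (min (P.t (i + 1)) t) (min (P.t (j + 1)) t) -
      (π.part n).kernel (min (P.t (i + 1)) t) (min (P.t j) t) -
      (π.part n).kernel (min (P.t i) t) (min (P.t (j + 1)) t) +
      (π.part n).kernel (min (P.t i) t) (min (P.t j) t) := by
    simp only [UnitPartition.kernel]
    rw [← Finset.sum_sub_distrib, ← Finset.sum_sub_distrib, ← Finset.sum_add_distrib]
    exact Finset.sum_congr rfl fun a _ => by simp only [UnitPartition.incr]; ring
  rw [e2]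
  simp only [UnitPartition.overlap]
  ring

/-- Exchanging the roles of coefficients and intervals of P makes the bound independent of n. In the
Gram matrix, `H k i` is the length of the intersection of the k-th interval of π^n, the i-th
interval of P and [0,t]. -/
theorem Refining.sum_sq_gram_le (h : π.Refining) (n : ℕ) (P : UnitPartition) {t : ℝ}
    (ht : t ∈ Icc (0 : ℝ) 1) :
    ∑ p ∈ π.truncIndex n ×ˢ π.truncIndex n, (∑ i ∈ Finset.range P.N,
      P.incr (π.schauderFn p.1) t i * P.incr (π.schauderFn p.2) t i) ^ 2 ≤ 2 * P.mesh := by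
  rw [sum_product_sq_sum_mul _ _ fun a i => P.incr (π.schauderFn a) t i]
  rw [Finset.sum_congr rfl fun i hi => Finset.sum_congr rfl fun j hj => by
    rw [h.gram_eq n P ht (Finset.mem_range.1 hi) (Finset.mem_range.1 hj)]]
  refine _root_.sum_sq_gram_le (Finset.range (π.N n)) (Finset.range P.N)
    (H := fun k i => P.incr ((π.part n).overlap k) t i) (v := fun i => P.overlap i t)
    (l := fun k => π.t n (k + 1) - π.t n k) P.mesh_pos.le ?_ ?_ ?_ ?_ ?_ ?_
  · intro k hk i hi
    exact sub_nonneg.2 ((π.part n).overlap_mono (Finset.mem_range.1 hk)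
      (min_le_min_right _ (P.t_lt i (Finset.mem_range.1 hi)).le))
  · exact fun k hk => (π.part n).length_pos (Finset.mem_range.1 hk)
  · intro k hk
    rw [P.sum_incr _ ht, (π.part n).overlap_zero (Finset.mem_range.1 hk), sub_zero]
    exact (π.part n).overlap_le (Finset.mem_range.1 hk) t
  · intro i hi
    have hi := Finset.mem_range.1 hi
    simp only [UnitPartition.incr]
    rw [Finset.sum_sub_distrib, (π.part n).sum_overlap (P.min_mem ht (i := i + 1) hi),
      (π.part n).sum_overlap (P.min_mem ht hi.le)]
    rfl
  · exact fun i hi => (P.overlap_le (Finset.mem_range.1 hi) t).trans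
      (P.length_le_mesh (Finset.mem_range.1 hi))
  · rw [P.sum_overlap ht]
    exact ht.2

theorem FinitelyRefining.tendsto_kernel (h : π.FinitelyRefining) {s t : ℝ}
    (hs : s ∈ Icc (0 : ℝ) 1) (ht : t ∈ Icc (0 : ℝ) 1) :
    Tendsto (fun n => (π.part n).kernel s t) atTop (𝓝 (min s t)) := by
  have key : ∀ {s t : ℝ}, s ∈ Icc (0 : ℝ) 1 → s ≤ t →
      Tendsto (fun n => (π.part n).kernel s t) atTop (𝓝 s) := by
    intro s t hs hst
    have h1 : Tendsto (fun n => s - (π.part n).kernel s t) atTop (𝓝 0) :=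
      squeeze_zero (fun n => ((π.part n).min_sub_kernel_mem hs hst).1)
        (fun n => ((π.part n).min_sub_kernel_mem hs hst).2) h.mesh_tendsto
    simpa using h1.const_sub s
  rcases le_total s t with hst | hst
  · rw [min_eq_left hst]
    exact key hs hst
  · rw [min_eq_right hst]
    simp_rw [UnitPartition.kernel_comm _ s t]
    exact key ht hst

/-- The expected quadratic variation along `P` of the truncated Schauder expansion. -/
def truncTrace (π : PartitionSeq) (P : UnitPartition) (t : ℝ) (n : ℕ) : ℝ :=
  ∑ a ∈ π.truncIndex n, ∑ i ∈ Finset.range P.N,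
    P.incr (π.schauderFn a) t i * P.incr (π.schauderFn a) t i

/-- A Brownian bridge increment over an interval of length h has variance h - h², and the lengths
stopped at t add up to t. -/
theorem FinitelyRefining.tendsto_truncTrace (h : π.FinitelyRefining) (P : UnitPartition) {t : ℝ}
    (ht : t ∈ Icc (0 : ℝ) 1) :
    Tendsto (π.truncTrace P t) atTop
      (𝓝 (t - ∑ i ∈ Finset.range P.N, P.overlap i t ^ 2)) := by
  have e : t - ∑ i ∈ Finset.range P.N, P.overlap i t ^ 2 =
      ∑ i ∈ Finset.range P.N, (P.overlap i t - P.overlap i t ^ 2) := by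
    rw [Finset.sum_sub_distrib, P.sum_overlap ht]
  rw [e]
  have e2 : π.truncTrace P t = fun n => ∑ i ∈ Finset.range P.N, ∑ a ∈ π.truncIndex n,
      P.incr (π.schauderFn a) t i * P.incr (π.schauderFn a) t i := by
    funext n
    exact Finset.sum_comm
  rw [e2]
  refine tendsto_finsetSum _ fun i hi => ?_
  have hi := Finset.mem_range.1 hi
  have mi := P.min_mem ht hi.le
  have mi' := P.min_mem ht (i := i + 1) hi
  have hle : min (P.t i) t ≤ min (P.t (i + 1)) t := min_le_min_right _ (P.t_lt i hi).le
  have e3 : ∀ n, ∑ a ∈ π.truncIndex n,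
      P.incr (π.schauderFn a) t i * P.incr (π.schauderFn a) t i =
      (π.part n).kernel (min (P.t (i + 1)) t) (min (P.t (i + 1)) t) -
        (π.part n).kernel (min (P.t i) t) (min (P.t (i + 1)) t) -
        (π.part n).kernel (min (P.t i) t) (min (P.t (i + 1)) t) +
        (π.part n).kernel (min (P.t i) t) (min (P.t i) t) - P.overlap i t ^ 2 := by
    intro n
    have h1 := h.refining.sum_trunc_schauder_mul n mi' mi'
    have h2 := h.refining.sum_trunc_schauder_mul n mi mi'
    have h3 := h.refining.sum_trunc_schauder_mul n mi mi
    have : ∑ a ∈ π.truncIndex n, P.incr (π.schauderFn a) t i * P.incr (π.schauderFn a) t i =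
        ∑ a ∈ π.truncIndex n, π.schauderFn a (min (P.t (i + 1)) t) *
          π.schauderFn a (min (P.t (i + 1)) t) -
        2 * ∑ a ∈ π.truncIndex n, π.schauderFn a (min (P.t i) t) *
          π.schauderFn a (min (P.t (i + 1)) t) +
        ∑ a ∈ π.truncIndex n, π.schauderFn a (min (P.t i) t) *
          π.schauderFn a (min (P.t i) t) := by
      rw [Finset.mul_sum, ← Finset.sum_sub_distrib, ← Finset.sum_add_distrib]
      exact Finset.sum_congr rfl fun a _ => by simp only [UnitPartition.incr]; ring
    rw [this, h1, h2, h3]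
    simp only [UnitPartition.overlap]
    ring
  simp_rw [e3]
  have l1 := h.tendsto_kernel mi' mi'
  have l2 := h.tendsto_kernel mi mi'
  have l3 := h.tendsto_kernel mi mi
  rw [min_self] at l1 l3
  rw [min_eq_left hle] at l2
  have := (((l1.sub l2).sub l2).add l3).sub_const (P.overlap i t ^ 2)
  convert this using 2
  simp only [UnitPartition.overlap]
  ring

end PartitionSeq

/-! ### Mean square estimate, almost sure convergence and convergence in probability. -/

namespace PartitionSeq

section Truncation

variable {Ω : Type*} {π : PartitionSeq}

/-- The pure Schauder part of a truncated expansion. -/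
def truncSum (π : PartitionSeq) (η : ℕ × ℕ × ℕ → Ω → ℝ) (n : ℕ) (ω : Ω) (s : ℝ) : ℝ :=
  ∑ a ∈ π.truncIndex n, η a ω * π.schauderFn a s

/-- Expanding the squares and subtracting E(η_a η_b) separates the random fluctuation from the mean
`truncTrace`. -/
theorem qv_truncSum (η : ℕ × ℕ × ℕ → Ω → ℝ) (n : ℕ) (P : UnitPartition) (t : ℝ) (ω : Ω) :
    P.qv (π.truncSum η n ω) t =
      ∑ p ∈ π.truncIndex n ×ˢ π.truncIndex n, (∑ i ∈ Finset.range P.N,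
        P.incr (π.schauderFn p.1) t i * P.incr (π.schauderFn p.2) t i) *
        FourthOrderIndep.centredMul η p ω + π.truncTrace P t n := by
  have h1 : ∀ i, P.incr (π.truncSum η n ω) t i =
      ∑ a ∈ π.truncIndex n, η a ω * P.incr (π.schauderFn a) t i := fun i => by
    simp only [UnitPartition.incr, truncSum, mul_sub, Finset.sum_sub_distrib]
  have h2 : π.truncTrace P t n = ∑ p ∈ π.truncIndex n ×ˢ π.truncIndex n,
      (∑ i ∈ Finset.range P.N,
        P.incr (π.schauderFn p.1) t i * P.incr (π.schauderFn p.2) t i) *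
        (if p.1 = p.2 then 1 else 0) := by
    rw [Finset.sum_product, truncTrace]
    refine Finset.sum_congr rfl fun a ha => ?_
    simp [ha]
  rw [h2, ← Finset.sum_add_distrib, UnitPartition.qv_eq]
  have h3 : ∀ p : (ℕ × ℕ × ℕ) × (ℕ × ℕ × ℕ), (∑ i ∈ Finset.range P.N,
        P.incr (π.schauderFn p.1) t i * P.incr (π.schauderFn p.2) t i) *
        FourthOrderIndep.centredMul η p ω + (∑ i ∈ Finset.range P.N,
        P.incr (π.schauderFn p.1) t i * P.incr (π.schauderFn p.2) t i) *
        (if p.1 = p.2 then 1 else 0) = ∑ i ∈ Finset.range P.N,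
        (η p.1 ω * P.incr (π.schauderFn p.1) t i) *
        (η p.2 ω * P.incr (π.schauderFn p.2) t i) := fun p => by
    rw [← mul_add, FourthOrderIndep.centredMul, sub_add_cancel, Finset.sum_mul]
    exact Finset.sum_congr rfl fun i _ => by ring
  simp_rw [h3]
  rw [Finset.sum_comm]
  refine Finset.sum_congr rfl fun i _ => ?_
  rw [h1, pow_two, Finset.sum_mul_sum, Finset.sum_product]

variable [MeasurableSpace Ω] {μ : Measure Ω}

theorem aemeasurable_qv {y : ℝ → Ω → ℝ} (hy : ∀ s ∈ Icc (0 : ℝ) 1, AEMeasurable (y s) μ)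
    (P : UnitPartition) {t : ℝ} (ht : t ∈ Icc (0 : ℝ) 1) :
    AEMeasurable (fun ω => P.qv (fun s => y s ω) t) μ := by
  refine Finset.aemeasurable_fun_sum _ fun i hi => ?_
  have hi := Finset.mem_range.1 hi
  exact ((hy _ (P.min_mem ht (i := i + 1) hi)).sub (hy _ (P.min_mem ht hi.le))).pow_const 2

variable [IsProbabilityMeasure μ] {η : ℕ × ℕ × ℕ → Ω → ℝ} {M : ℝ}

theorem aemeasurable_qv_truncSum (h : FourthOrderIndep μ π.haarIndex η M) (n : ℕ)
    (P : UnitPartition) (t : ℝ) :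
    AEMeasurable (fun ω => P.qv (π.truncSum η n ω) t) μ := by
  simp_rw [qv_truncSum]
  refine AEMeasurable.add_const (Finset.aemeasurable_fun_sum _ fun p hp => ?_) _
  have hp := Finset.mem_product.1 hp
  exact (h.memLp_centredMul (mem_truncIndex.1 hp.1).2
    (mem_truncIndex.1 hp.2).2).aestronglyMeasurable.aemeasurable.const_mul _

/-- Variance plus squared bias, through (u + v)² ≤ 2u² + 2v². The 8 is this 2, times the 2 of the
variance bound, times the 2 of the Gram bound. -/
theorem lintegral_qv_truncSum_sub_le (hπ : π.FinitelyRefining)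
    (h : FourthOrderIndep μ π.haarIndex η M) (n : ℕ) (P : UnitPartition) {t : ℝ}
    (ht : t ∈ Icc (0 : ℝ) 1) :
    ∫⁻ ω, ENNReal.ofReal ((P.qv (π.truncSum η n ω) t - t) ^ 2) ∂μ ≤
      ENNReal.ofReal (8 * max M 1 * P.mesh + 2 * (π.truncTrace P t n - t) ^ 2) := by
  let g : (ℕ × ℕ × ℕ) × (ℕ × ℕ × ℕ) → ℝ := fun p => ∑ i ∈ Finset.range P.N,
    P.incr (π.schauderFn p.1) t i * P.incr (π.schauderFn p.2) t i
  let Z : Ω → ℝ := fun ω => ∑ p ∈ π.truncIndex n ×ˢ π.truncIndex n,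
    g p * FourthOrderIndep.centredMul η p ω
  have hZ : MemLp Z 2 μ := by
    refine memLp_finsetSum _ fun p hp => ?_
    have hp := Finset.mem_product.1 hp
    exact (h.memLp_centredMul (mem_truncIndex.1 hp.1).2 (mem_truncIndex.1 hp.2).2).const_mul _
  have hZ2 : ∫ ω, Z ω ^ 2 ∂μ ≤ 2 * max M 1 * (2 * P.mesh) := by
    refine (h.integral_sq_sum_centredMul_le hπ.infinite_haarIndex
      (fun a ha => (mem_truncIndex.1 ha).2) (g := g) ?_).trans ?_
    · intro p
      simp only [g, Prod.fst_swap, Prod.snd_swap, mul_comm]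
    · exact mul_le_mul_of_nonneg_left (hπ.refining.sum_sq_gram_le n P ht) (by positivity)
  have hint : Integrable (fun ω => 2 * Z ω ^ 2 + 2 * (π.truncTrace P t n - t) ^ 2) μ :=
    (hZ.integrable_sq.const_mul 2).add (integrable_const _)
  calc _ ≤ ∫⁻ ω, ENNReal.ofReal (2 * Z ω ^ 2 + 2 * (π.truncTrace P t n - t) ^ 2) ∂μ := by
        refine lintegral_mono fun ω => ENNReal.ofReal_le_ofReal ?_
        rw [qv_truncSum]
        change (Z ω + π.truncTrace P t n - t) ^ 2 ≤ _
        nlinarith [sq_nonneg (Z ω - (π.truncTrace P t n - t))]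
    _ = ENNReal.ofReal (∫ ω, (2 * Z ω ^ 2 + 2 * (π.truncTrace P t n - t) ^ 2) ∂μ) :=
        (ofReal_integral_eq_lintegral_ofReal hint (.of_forall fun ω => by positivity)).symm
    _ ≤ _ := by
        refine ENNReal.ofReal_le_ofReal ?_
        rw [integral_add (hZ.integrable_sq.const_mul 2) (integrable_const _), integral_const_mul]
        simp only [integral_const, probReal_univ, smul_eq_mul, one_mul]
        linarith

theorem tendsto_qv {P : UnitPartition} {f : ℕ → ℝ → ℝ} {g : ℝ → ℝ} {t : ℝ}
    (ht : t ∈ Icc (0 : ℝ) 1)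
    (h : ∀ s ∈ Icc (0 : ℝ) 1, Tendsto (fun n => f n s) atTop (𝓝 (g s))) :
    Tendsto (fun n => P.qv (f n) t) atTop (𝓝 (P.qv g t)) := by
  refine tendsto_finsetSum _ fun i hi => ?_
  have hi := Finset.mem_range.1 hi
  exact ((h _ (P.min_mem ht (i := i + 1) hi)).sub (h _ (P.min_mem ht hi.le))).pow 2

/-- Mean square estimate for the quadratic variation along one partition of a Schauder series with
fourth order independent coefficients. -/
theorem lintegral_qv_sub_le (hπ : π.FinitelyRefining)
    (h : FourthOrderIndep μ π.haarIndex η M) {y : ℝ → Ω → ℝ}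
    (hy : ∀ᵐ ω ∂μ, ∀ s ∈ Icc (0 : ℝ) 1,
      Tendsto (fun n => π.truncSum η n ω s) atTop (𝓝 (y s ω)))
    (P : UnitPartition) {t : ℝ} (ht : t ∈ Icc (0 : ℝ) 1) :
    ∫⁻ ω, ENNReal.ofReal ((P.qv (fun s => y s ω) t - t) ^ 2) ∂μ ≤
      ENNReal.ofReal ((8 * max M 1 + 2) * P.mesh) := by
  set q := ∑ i ∈ Finset.range P.N, P.overlap i t ^ 2 with hq
  have hq0 : 0 ≤ q := Finset.sum_nonneg fun i _ => sq_nonneg _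
  have hq1 : q ≤ P.mesh := P.sum_overlap_sq_le ht
  have hlim : Tendsto (fun n => ENNReal.ofReal (8 * max M 1 * P.mesh +
      2 * (π.truncTrace P t n - t) ^ 2)) atTop
      (𝓝 (ENNReal.ofReal (8 * max M 1 * P.mesh + 2 * (t - q - t) ^ 2))) :=
    ENNReal.tendsto_ofReal
      (((((hπ.tendsto_truncTrace P ht).sub_const t).pow 2).const_mul 2).const_add _)
  -- Fatou's lemma passes to the limit using only the pointwise convergence of the series.
  calc _ = ∫⁻ ω, liminf (fun n => ENNReal.ofReal ((P.qv (π.truncSum η n ω) t - t) ^ 2))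
        atTop ∂μ := by
        refine lintegral_congr_ae ?_
        filter_upwards [hy] with ω hω
        exact (ENNReal.tendsto_ofReal
          (((tendsto_qv ht hω).sub_const t).pow 2)).liminf_eq.symm
    _ ≤ liminf (fun n => ∫⁻ ω, ENNReal.ofReal ((P.qv (π.truncSum η n ω) t - t) ^ 2) ∂μ)
        atTop := by
        refine lintegral_liminf_le' fun n => ?_
        exact (((aemeasurable_qv_truncSum h n P t).sub_const t).pow_const 2).ennreal_ofReal
    _ ≤ liminf (fun n => ENNReal.ofReal (8 * max M 1 * P.mesh +
          2 * (π.truncTrace P t n - t) ^ 2)) atTop :=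
        liminf_le_liminf (.of_forall fun n => lintegral_qv_truncSum_sub_le hπ h n P ht)
    _ = _ := hlim.liminf_eq
    _ ≤ _ := by
        refine ENNReal.ofReal_le_ofReal ?_
        -- The limiting bias is -q with 0 ≤ q ≤ |P| ≤ 1, hence 2q² ≤ 2|P|.
        nlinarith [P.mesh_le_one, P.mesh_pos]

/-- The expected sum of the squared errors is finite, so the errors are almost surely square
summable and tend to 0. -/
theorem ae_tendsto_qv_of_summable_mesh (hπ : π.FinitelyRefining)
    (h : FourthOrderIndep μ π.haarIndex η M) {y : ℝ → Ω → ℝ}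
    (hmeas : ∀ s ∈ Icc (0 : ℝ) 1, AEMeasurable (y s) μ)
    (hy : ∀ᵐ ω ∂μ, ∀ s ∈ Icc (0 : ℝ) 1,
      Tendsto (fun n => π.truncSum η n ω s) atTop (𝓝 (y s ω)))
    {P : ℕ → UnitPartition} (hP : Summable fun n => (P n).mesh) {t : ℝ}
    (ht : t ∈ Icc (0 : ℝ) 1) :
    ∀ᵐ ω ∂μ, Tendsto (fun n => (P n).qv (fun s => y s ω) t) atTop (𝓝 t) := by
  have hm : ∀ n, AEMeasurable
      (fun ω => ENNReal.ofReal (((P n).qv (fun s => y s ω) t - t) ^ 2)) μ :=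
    fun n => (((aemeasurable_qv hmeas (P n) ht).sub_const t).pow_const 2).ennreal_ofReal
  have hfin : ∫⁻ ω, ∑' n, ENNReal.ofReal (((P n).qv (fun s => y s ω) t - t) ^ 2) ∂μ ≠ ⊤ := by
    rw [lintegral_tsum hm]
    refine ne_top_of_le_ne_top ?_
      (ENNReal.tsum_le_tsum fun n => lintegral_qv_sub_le hπ h hy (P n) ht)
    exact (hP.mul_left (8 * max M 1 + 2)).tsum_ofReal_ne_top
  filter_upwards [ae_lt_top' (AEMeasurable.tsum hm) hfin] with ω hω
  have h0 := ENNReal.tendsto_atTop_zero_of_tsum_ne_top hω.ne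
  have h1 : Tendsto (fun n => ((P n).qv (fun s => y s ω) t - t) ^ 2) atTop (𝓝 0) := by
    have := (ENNReal.tendsto_toReal ENNReal.zero_ne_top).comp h0
    simpa [Function.comp_def, ENNReal.toReal_ofReal (sq_nonneg _)] using this
  have h2 : Tendsto (fun n => (P n).qv (fun s => y s ω) t - t) atTop (𝓝 0) := by
    have := h1.sqrt
    simp only [Real.sqrt_sq_eq_abs, Real.sqrt_zero] at this
    exact (tendsto_zero_iff_abs_tendsto_zero _).2 this
  simpa using h2.add_const t

end Truncation

/-- Adding an affine function does not change the quadratic variation. -/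
theorem _root_.UnitPartition.tendsto_qv_add_affine {P : ℕ → UnitPartition}
    (hP : Tendsto (fun n => (P n).mesh) atTop (𝓝 0)) {f g : ℝ → ℝ} {a b t q : ℝ}
    (ht : t ∈ Icc (0 : ℝ) 1) (hfg : ∀ s ∈ Icc (0 : ℝ) 1, g s = f s + (a + b * s))
    (hf : Tendsto (fun n => (P n).qv f t) atTop (𝓝 q)) :
    Tendsto (fun n => (P n).qv g t) atTop (𝓝 q) := by
  have hD : Tendsto (fun n => ∑ i ∈ Finset.range (P n).N, (P n).overlap i t ^ 2) atTop (𝓝 0) :=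
    squeeze_zero (fun n => Finset.sum_nonneg fun i _ => sq_nonneg _)
      (fun n => (P n).sum_overlap_sq_le ht) hP
  have hC : Tendsto (fun n => ∑ i ∈ Finset.range (P n).N, (P n).incr f t i * (P n).overlap i t)
      atTop (𝓝 0) := by
    have hsq : Tendsto (fun n => (∑ i ∈ Finset.range (P n).N,
        (P n).incr f t i * (P n).overlap i t) ^ 2) atTop (𝓝 0) := by
      -- By Cauchy–Schwarz the squared cross term is at most the convergent quadratic variation of f
      -- times ∑ `overlap`², which tends to 0.
      refine squeeze_zero (fun n => sq_nonneg _)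
        (fun n => Finset.sum_mul_sq_le_sq_mul_sq _ _ _) ?_
      have hmul := hf.mul hD
      rw [mul_zero] at hmul
      exact hmul
    have := hsq.sqrt
    simp only [Real.sqrt_sq_eq_abs, Real.sqrt_zero] at this
    exact (tendsto_zero_iff_abs_tendsto_zero _).2 this
  have e : ∀ n, (P n).qv g t = (P n).qv f t +
      2 * b * (∑ i ∈ Finset.range (P n).N, (P n).incr f t i * (P n).overlap i t) +
      b ^ 2 * ∑ i ∈ Finset.range (P n).N, (P n).overlap i t ^ 2 := by
    intro n
    rw [UnitPartition.qv_eq, UnitPartition.qv_eq, Finset.mul_sum, Finset.mul_sum,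
      ← Finset.sum_add_distrib, ← Finset.sum_add_distrib]
    refine Finset.sum_congr rfl fun i hi => ?_
    have hi := Finset.mem_range.1 hi
    rw [UnitPartition.incr, hfg _ ((P n).min_mem ht (i := i + 1) hi),
      hfg _ ((P n).min_mem ht hi.le)]
    simp only [UnitPartition.incr, UnitPartition.overlap]
    ring
  simp_rw [e]
  simpa using (hf.add (hC.const_mul (2 * b))).add (hD.const_mul (b ^ 2))

section ClassA

variable {Ω : Type*} [MeasurableSpace Ω] {μ : Measure Ω} {π : PartitionSeq} {x : ℝ → Ω → ℝ}

theorem ClassA.exists_coeff (hx : π.ClassA μ x) :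
    ∃ (η : ℕ × ℕ × ℕ → Ω → ℝ) (M : ℝ), FourthOrderIndep μ π.haarIndex η M ∧
      ∀ᵐ ω ∂μ, ∀ s ∈ Icc (0 : ℝ) 1, Tendsto (fun n => π.truncSum η n ω s) atTop
        (𝓝 (x s ω - (x 0 ω + (x 1 ω - x 0 ω) * s))) := by
  obtain ⟨-, η, hser, h4, h0, h2, ⟨M, hM⟩, hf⟩ := hx
  refine ⟨η, M, ⟨h4, h0, fun a ha => ?_, fun a ha b hb hab => ?_, hM, hf⟩, ?_⟩
  · rw [h2 a ha a ha, if_pos rfl]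
  · rw [h2 a ha b hb, if_neg hab]
  · filter_upwards [hser] with ω hω s hs
    have := (hω s hs).sub_const (x 0 ω + (x 1 ω - x 0 ω) * s)
    simpa [schauderPartialSum_eq, truncSum] using this

variable [IsProbabilityMeasure μ]

theorem ClassA.ae_tendsto_qv (hπ : π.FinitelyRefining) (hx : π.ClassA μ x)
    {P : ℕ → UnitPartition} (hP : Summable fun n => (P n).mesh) {t : ℝ}
    (ht : t ∈ Icc (0 : ℝ) 1) :
    ∀ᵐ ω ∂μ, Tendsto (fun n => (P n).qv (fun s => x s ω) t) atTop (𝓝 t) := by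
  obtain ⟨η, M, hη, hlim⟩ := hx.exists_coeff
  have m0 := hx.1 0 ⟨le_rfl, zero_le_one⟩
  have m1 := hx.1 1 ⟨zero_le_one, le_rfl⟩
  filter_upwards [ae_tendsto_qv_of_summable_mesh hπ hη
    (y := fun s ω => x s ω - (x 0 ω + (x 1 ω - x 0 ω) * s))
    (fun s hs => (hx.1 s hs).sub (m0.add ((m1.sub m0).mul_const s))) hlim hP ht] with ω hω
  exact UnitPartition.tendsto_qv_add_affine hP.tendsto_atTop_zero (a := x 0 ω)
    (b := x 1 ω - x 0 ω) ht (fun s _ => by ring) hω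

theorem ClassA.tendstoInMeasure_qv (hπ : π.FinitelyRefining) (hx : π.ClassA μ x)
    {P : ℕ → UnitPartition} (hP : Tendsto (fun n => (P n).mesh) atTop (𝓝 0)) {t : ℝ}
    (ht : t ∈ Icc (0 : ℝ) 1) :
    TendstoInMeasure μ (fun n ω => (P n).qv (fun s => x s ω) t) atTop (fun _ => t) := by
  -- No moments of x(0) and x(1) are available, so the mean square bound does not apply to x itself.
  -- Almost sure convergence along subsequences with mesh below 2^(-k) suffices.
  rw [exists_seq_tendstoInMeasure_atTop_iff fun n =>
    (aemeasurable_qv hx.1 (P n) ht).aestronglyMeasurable]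
  intro ns hns
  have h1 : ∀ k : ℕ, ∀ᶠ n in atTop, (P (ns n)).mesh < (1 / 2 : ℝ) ^ k := fun k =>
    (hP.comp hns.tendsto_atTop).eventually_lt_const (by positivity)
  obtain ⟨ns', hns', hlt⟩ := extraction_forall_of_eventually h1
  exact ⟨ns', hns', hx.ae_tendsto_qv hπ (P := fun k => P (ns (ns' k)))
    (Summable.of_nonneg_of_le (fun k => (P _).mesh_pos.le) (fun k => (hlt k).le)
      summable_geometric_two) ht⟩

end ClassA

end PartitionSeq

/-! ### Continuity of paths in the balanced, complete refining case. -/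

namespace PartitionSeq

variable {π : PartitionSeq}

theorem CompleteRefining.exists_rate (h : π.CompleteRefining) :
    ∃ r : ℝ, 0 < r ∧ r < 1 ∧ ∀ n, π.mesh (n + 1) ≤ r ^ n := by
  obtain ⟨ε, M, hε, -, hM⟩ := h
  refine ⟨(1 + ε)⁻¹, by positivity, inv_lt_one_of_one_lt₀ (by linarith), fun n => ?_⟩
  induction n with
  | zero => simpa using (π.part 1).mesh_le_one
  | succ n ih =>
    have h1 := (hM (n + 1) (by omega)).1
    rw [le_div_iff₀ (π.part (n + 1 + 1)).mesh_pos] at h1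
    rw [pow_succ', inv_mul_eq_div, le_div_iff₀ (by linarith), mul_comm]
    exact h1.trans ih

theorem CompleteRefining.summable_mesh (h : π.CompleteRefining) : Summable π.mesh := by
  obtain ⟨r, hr0, hr1, hr⟩ := h.exists_rate
  exact (summable_nat_add_iff 1).1 (Summable.of_nonneg_of_le
    (fun n => (π.part (n + 1)).mesh_pos.le) hr (summable_geometric_of_lt_one hr0.le hr1))

/-- Up to constants, |π^n| is at most |π^{n+1}|, hence at most the smallest interval of π^{n+1}, and
N times that interval is at most 1. This keeps the number of coefficients at level n of order
1/|π^n|. -/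
theorem Balanced.exists_N_mul_mesh_le (hb : π.Balanced) (hc : π.CompleteRefining) :
    ∃ C : ℝ, 0 < C ∧ ∀ n, 1 ≤ n → π.N (n + 1) * π.mesh n ≤ C := by
  obtain ⟨c, hc0, hcb⟩ := hb
  obtain ⟨ε, M, -, hM0, hM⟩ := hc
  refine ⟨M * c, by positivity, fun n hn => ?_⟩
  have h1 : π.mesh n ≤ M * π.mesh (n + 1) := by
    have := (hM n hn).2
    rwa [div_le_iff₀ (π.part (n + 1)).mesh_pos] at this
  have h2 : π.mesh (n + 1) ≤ c * π.minMesh (n + 1) := by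
    have := hcb (n + 1) (by omega)
    rwa [div_le_iff₀ (π.part (n + 1)).minMesh_pos] at this
  have h3 := (π.part (n + 1)).N_mul_minMesh_le
  calc π.N (n + 1) * π.mesh n ≤ π.N (n + 1) * (M * (c * π.minMesh (n + 1))) := by
        gcongr
        exact h1.trans (by gcongr)
    _ = M * c * (π.N (n + 1) * π.minMesh (n + 1)) := by ring
    _ ≤ M * c * 1 := by gcongr
    _ = M * c := mul_one _

theorem FinitelyRefining.exists_card_branchIndex_le (h : π.FinitelyRefining) :
    ∃ B : ℕ, ∀ n, 1 ≤ n → ∀ k < π.N n, (π.branchIndex n k).card ≤ B := by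
  obtain ⟨B, hB⟩ := h.bounded_branching
  refine ⟨B, fun n hn k hk => le_trans ?_ (hB n hn k hk)⟩
  have hp := h.refining.t_p hk.le
  have hp' := h.refining.t_p (k := k + 1) hk
  have hlt := h.refining.p_lt_p_succ hk
  calc (π.branchIndex n k).card ≤ (Finset.Icc (π.p n k) (π.p n (k + 1))).card := by
        rw [branchIndex, Nat.card_Icc, Nat.card_Icc]
        omega
    _ = ((Finset.Icc (π.p n k) (π.p n (k + 1))).image (π.t (n + 1))).card := by
        refine (Finset.card_image_of_injOn fun i hi j hj hij => ?_).symm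
        have hi := Finset.mem_Icc.1 (Finset.mem_coe.1 hi)
        have hj := Finset.mem_Icc.1 (Finset.mem_coe.1 hj)
        exact UnitPartition.t_injOn (π.part (n + 1)) (hi.2.trans hp'.1) (hj.2.trans hp'.1) hij
    _ ≤ _ := by
        refine Finset.card_le_card fun s hs => ?_
        obtain ⟨j, hj, rfl⟩ := Finset.mem_image.1 hs
        have hj := Finset.mem_Icc.1 hj
        have hjN := hj.2.trans hp'.1
        rw [Finset.mem_filter, UnitPartition.mem_points, ← hp.2, ← hp'.2]
        exact ⟨⟨j, hjN, rfl⟩, UnitPartition.t_mono _ hj.1 hjN, UnitPartition.t_mono _ hj.2 hp'.1⟩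

theorem Refining.add_le_of_mem_branchIndex (h : π.Refining) {m k i : ℕ} (hk : k < π.N m)
    (hi : i ∈ π.branchIndex m k) : 2 ≤ i ∧ π.p m k + i ≤ π.p m (k + 1) := by
  have hi := Finset.mem_Icc.1 hi
  have := h.p_lt_p_succ hk
  exact ⟨hi.1, by omega⟩

theorem Refining.continuousOn_schauderFn (h : π.Refining) {a : ℕ × ℕ × ℕ} (ha : a ∈ π.haarIndex) :
    ContinuousOn (π.schauderFn a) (Icc 0 1) := by
  obtain ⟨m, k, i⟩ := a
  obtain ⟨hk, hi⟩ := ha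
  have hi := h.add_le_of_mem_branchIndex hk hi
  have hN := hi.2.trans (h.t_p (k := k + 1) hk).1
  refine ContinuousOn.congr (Continuous.continuousOn ?_)
    fun s hs => schauder_eq (by omega) hN hs.1
  fun_prop

/-- The contribution of level `m` to a Schauder series with coefficients `θ`. -/
def levelSum (π : PartitionSeq) (θ : ℕ × ℕ × ℕ → ℝ) (m : ℕ) (s : ℝ) : ℝ :=
  ∑ a ∈ π.levelIndex m, θ a * π.schauderFn a s

/-- Only the functions living on the interval around s are nonzero at s. Cauchy–Schwarz applies,
with ∑ e_a(s)² ≤ K_{m+1}(s,s) - K_m(s,s) ≤ s - K_m(s,s) ≤ |π^m|. -/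
theorem Refining.levelSum_sq_le (h : π.Refining) (θ : ℕ × ℕ × ℕ → ℝ) {m k : ℕ} (hk : k < π.N m)
    {s : ℝ} (hs : s ∈ Icc (0 : ℝ) 1) (hs1 : π.t m k ≤ s) (hs2 : s ≤ π.t m (k + 1)) :
    π.levelSum θ m s ^ 2 ≤ (∑ i ∈ π.branchIndex m k, θ (m, k, i) ^ 2) * π.mesh m := by
  have h1 : π.levelSum θ m s =
      ∑ i ∈ π.branchIndex m k, θ (m, k, i) * π.schauderFn (m, k, i) s := by
    rw [levelSum, sum_levelIndex]
    refine Finset.sum_eq_single_of_mem k (Finset.mem_range.2 hk) fun k' hk' hne => ?_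
    have hk' := Finset.mem_range.1 hk'
    refine Finset.sum_eq_zero fun i hi => ?_
    have hi := h.add_le_of_mem_branchIndex hk' hi
    have hp := h.t_p hk'.le
    have hp' := h.t_p (k := k' + 1) hk'
    have hle : π.t (m + 1) (π.p m k' + i) ≤ π.t m (k' + 1) := by
      rw [← hp'.2]
      exact UnitPartition.t_mono _ hi.2 hp'.1
    rw [schauderFn, schauder_eq_zero hi.1 (hi.2.trans hp'.1) hs.1, mul_zero]
    rcases lt_or_gt_of_ne hne with hlt | hlt
    · exact Or.inr (hle.trans ((UnitPartition.t_mono _ (by omega) hk.le).trans hs1))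
    · left
      rw [hp.2]
      exact hs2.trans (UnitPartition.t_mono _ (by omega) hk'.le)
  have h2 : ∑ i ∈ π.branchIndex m k, π.schauderFn (m, k, i) s ^ 2 ≤ π.mesh m := by
    calc _ ≤ ∑ a ∈ π.levelIndex m, π.schauderFn a s * π.schauderFn a s := by
          rw [sum_levelIndex]
          simp_rw [← pow_two]
          exact Finset.single_le_sum (f := fun k => ∑ i ∈ π.branchIndex m k,
            π.schauderFn (m, k, i) s ^ 2)
            (fun _ _ => Finset.sum_nonneg fun _ _ => sq_nonneg _) (Finset.mem_range.2 hk)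
      _ ≤ π.mesh m := by
          rw [h.sum_level_schauder_mul m hs.1 hs.1]
          linarith [((π.part m).min_sub_kernel_mem hs le_rfl).2,
            ((π.part (m + 1)).min_sub_kernel_mem hs le_rfl).1]
  rw [h1]
  exact (Finset.sum_mul_sq_le_sq_mul_sq _ _ _).trans
    (mul_le_mul_of_nonneg_left h2 (Finset.sum_nonneg fun _ _ => sq_nonneg _))

/-- Summing over the whole level instead of the interval around s makes the right side independent
of s, hence a bound for the supremum. -/
theorem Refining.levelSum_pow_four_le (h : π.Refining) (θ : ℕ × ℕ × ℕ → ℝ) {m B : ℕ}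
    (hB : ∀ k < π.N m, (π.branchIndex m k).card ≤ B) {s : ℝ} (hs : s ∈ Icc (0 : ℝ) 1) :
    π.levelSum θ m s ^ 4 ≤ B * π.mesh m ^ 2 * ∑ a ∈ π.levelIndex m, θ a ^ 4 := by
  obtain ⟨k, hk, hs1, hs2⟩ : ∃ k < π.N m, π.t m k ≤ s ∧ s ≤ π.t m (k + 1) := by
    rcases hs.2.lt_or_eq with hlt | rfl
    · obtain ⟨k, hk, h1, h2⟩ := (π.part m).exists_mem_interval ⟨hs.1, hlt⟩
      exact ⟨k, hk, h1, h2.le⟩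
    · have hN : 0 < π.N m := (π.part m).N_pos
      refine ⟨π.N m - 1, by omega, UnitPartition.t_le_one _ (Nat.sub_le _ _), ?_⟩
      rw [Nat.sub_add_cancel hN]
      exact (UnitPartition.t_last _).ge
  have h1 := h.levelSum_sq_le θ hk hs hs1 hs2
  set S := ∑ i ∈ π.branchIndex m k, θ (m, k, i) ^ 2
  have hS : S ^ 2 ≤ B * ∑ a ∈ π.levelIndex m, θ a ^ 4 := by
    calc S ^ 2 ≤ (π.branchIndex m k).card * ∑ i ∈ π.branchIndex m k, (θ (m, k, i) ^ 2) ^ 2 :=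
          sq_sum_le_card_mul_sum_sq
      _ ≤ B * ∑ a ∈ π.levelIndex m, θ a ^ 4 := by
          refine mul_le_mul (by exact_mod_cast hB k hk) ?_
            (Finset.sum_nonneg fun _ _ => sq_nonneg _) (Nat.cast_nonneg _)
          rw [sum_levelIndex]
          simp_rw [← pow_mul]
          exact Finset.single_le_sum (f := fun k => ∑ i ∈ π.branchIndex m k, θ (m, k, i) ^ 4)
            (fun _ _ => Finset.sum_nonneg fun _ _ => by positivity) (Finset.mem_range.2 hk)
  calc π.levelSum θ m s ^ 4 = (π.levelSum θ m s ^ 2) ^ 2 := by ring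
    _ ≤ (S * π.mesh m) ^ 2 := pow_le_pow_left₀ (sq_nonneg _) h1 2
    _ = S ^ 2 * π.mesh m ^ 2 := by ring
    _ ≤ (B * ∑ a ∈ π.levelIndex m, θ a ^ 4) * π.mesh m ^ 2 := by gcongr
    _ = _ := by ring

/-- Either |d| ≤ q, or |d| ≤ d⁴/q³. The bound is linear in Y, so fourth moments control it directly
in expectation. -/
theorem abs_le_add_div_of_pow_four_le {d Y q : ℝ} (hq : 0 < q) (hd : d ^ 4 ≤ Y) :
    |d| ≤ q + Y / q ^ 3 := by
  have hY : 0 ≤ Y := le_trans (by positivity) hd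
  rcases le_or_gt |d| q with h | h
  · exact h.trans (le_add_of_nonneg_right (by positivity))
  · have h1 : |d| ≤ Y / q ^ 3 := by
      rw [le_div_iff₀ (by positivity)]
      calc |d| * q ^ 3 ≤ |d| * |d| ^ 3 := by gcongr
        _ = d ^ 4 := by rw [← pow_succ', (by decide : Even 4).pow_abs]
        _ ≤ Y := hd
    linarith

/-- The M-test for Schauder series. -/
theorem Refining.continuousOn_of_tendsto (h : π.Refining) {θ : ℕ × ℕ × ℕ → ℝ} {y : ℝ → ℝ}
    {u : ℕ → ℝ} (hu : Summable u)
    (hle : ∀ n, ∀ s ∈ Icc (0 : ℝ) 1, |π.levelSum θ (n + 1) s| ≤ u n)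
    (hy : ∀ s ∈ Icc (0 : ℝ) 1,
      Tendsto (fun n => ∑ a ∈ π.truncIndex n, θ a * π.schauderFn a s) atTop (𝓝 (y s))) :
    ContinuousOn y (Icc 0 1) := by
  have hcont : ∀ m, ContinuousOn (π.levelSum θ m) (Icc 0 1) := fun m =>
    continuousOn_finsetSum _ fun a ha =>
      continuousOn_const.mul (h.continuousOn_schauderFn (mem_levelIndex.1 ha).2)
  have hsum : ContinuousOn (fun s => ∑' n, π.levelSum θ (n + 1) s) (Icc 0 1) :=
    continuousOn_tsum (fun n => hcont (n + 1)) hu hle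
  -- Level 0 stands apart because the bounds on branching and mesh ratios start at level 1; it is a
  -- finite sum of continuous functions.
  have hadd : ContinuousOn (fun s => π.levelSum θ 0 s + ∑' n, π.levelSum θ (n + 1) s) (Icc 0 1) :=
    (hcont 0).add hsum
  refine hadd.congr fun s hs => ?_
  have hsm : Summable fun n => π.levelSum θ (n + 1) s :=
    Summable.of_norm_bounded hu fun n => hle n s hs
  have h1 : HasSum (fun n => π.levelSum θ n s)
      (π.levelSum θ 0 s + ∑' n, π.levelSum θ (n + 1) s) := by
    have hs' := (summable_nat_add_iff (f := fun n => π.levelSum θ n s) 1).1 hsm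
    rw [← hs'.tsum_eq_zero_add]
    exact hs'.hasSum
  have h2 : ∀ n, ∑ a ∈ π.truncIndex n, θ a * π.schauderFn a s =
      ∑ m ∈ Finset.range n, π.levelSum θ m s := fun n => sum_truncIndex π n _
  exact tendsto_nhds_unique (hy s hs) ((tendsto_congr h2).2 h1.tendsto_sum_nat)

section ClassA

variable {Ω : Type*} [MeasurableSpace Ω] {μ : Measure Ω}

theorem _root_.MeasureTheory.MemLp.integrable_pow_four {f : Ω → ℝ} (hf : MemLp f 4 μ) :
    Integrable (fun ω => f ω ^ 4) μ :=
  ((hf.mul_four hf).integrable_mul (hf.mul_four hf)).congr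
    (.of_forall fun ω => by simp only [Pi.mul_apply]; ring)

/-- There are O(1/|π^{n+1}|) coefficients at level n + 1, so the n-th term has mean O(|π^{n+1}| /
q^{3n}), which is O(q^n) when the mesh is at most q^{4n}. -/
theorem ae_summable_levelIndex_pow_four (hb : π.Balanced) (hc : π.CompleteRefining)
    (hπ : π.Refining) {η : ℕ × ℕ × ℕ → Ω → ℝ} {M : ℝ}
    (h : FourthOrderIndep μ π.haarIndex η M) {q : ℝ} (hq0 : 0 < q) (hq1 : q < 1)
    (hq : ∀ n, π.mesh (n + 1) ≤ (q ^ 4) ^ n) :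
    ∀ᵐ ω ∂μ, Summable fun n =>
      π.mesh (n + 1) ^ 2 * (∑ a ∈ π.levelIndex (n + 1), η a ω ^ 4) / (q ^ n) ^ 3 := by
  obtain ⟨C, hC0, hC⟩ := hb.exists_N_mul_mesh_le hc
  set Y : ℕ → Ω → ℝ := fun n ω =>
    π.mesh (n + 1) ^ 2 * (∑ a ∈ π.levelIndex (n + 1), η a ω ^ 4) / (q ^ n) ^ 3
  have hY0 : ∀ n ω, 0 ≤ Y n ω := fun n ω => by
    have : 0 ≤ ∑ a ∈ π.levelIndex (n + 1), η a ω ^ 4 :=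
      Finset.sum_nonneg fun _ _ => by positivity
    positivity
  have hi : ∀ n, ∀ a ∈ π.levelIndex (n + 1), Integrable (fun ω => η a ω ^ 4) μ := fun n a ha =>
    (h.memLp a (mem_levelIndex.1 ha).2).integrable_pow_four
  have hYi : ∀ n, Integrable (Y n) μ := fun n =>
    ((integrable_finsetSum _ (hi n)).const_mul _).div_const _
  have hYle : ∀ n, ∫ ω, Y n ω ∂μ ≤ max M 1 * C * q ^ n := by
    intro n
    have h1 : ∑ a ∈ π.levelIndex (n + 1), ∫ ω, η a ω ^ 4 ∂μ ≤ max M 1 * π.N (n + 1 + 1) := by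
      calc _ ≤ ∑ a ∈ π.levelIndex (n + 1), max M 1 := Finset.sum_le_sum fun a ha =>
            (h.integral_pow_four a (mem_levelIndex.1 ha).2).trans (le_max_left _ _)
        _ = (π.N (n + 1 + 1) - π.N (n + 1)) * max M 1 := by
            rw [Finset.sum_const, nsmul_eq_mul, hπ.card_levelIndex]
        _ ≤ π.N (n + 1 + 1) * max M 1 := by gcongr; exact sub_le_self _ (Nat.cast_nonneg _)
        _ = _ := mul_comm _ _
    have h2 := hC (n + 1) (by omega)
    have hm := (π.part (n + 1)).mesh_pos
    simp only [Y]
    rw [integral_div, integral_const_mul, integral_finsetSum _ (hi n),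
      div_le_iff₀ (by positivity)]
    calc _ ≤ π.mesh (n + 1) ^ 2 * (max M 1 * π.N (n + 1 + 1)) := by gcongr
      _ = max M 1 * (π.N (n + 1 + 1) * π.mesh (n + 1)) * π.mesh (n + 1) := by ring
      _ ≤ max M 1 * C * (q ^ 4) ^ n := by
          gcongr
          exact hq n
      _ = max M 1 * C * q ^ n * (q ^ n) ^ 3 := by ring
  have hfin : ∫⁻ ω, ∑' n, ENNReal.ofReal (Y n ω) ∂μ ≠ ⊤ := by
    rw [lintegral_tsum fun n => (hYi n).aestronglyMeasurable.aemeasurable.ennreal_ofReal]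
    have hle : ∀ n, ∫⁻ ω, ENNReal.ofReal (Y n ω) ∂μ ≤ ENNReal.ofReal (max M 1 * C * q ^ n) :=
      fun n => by
        rw [← ofReal_integral_eq_lintegral_ofReal (hYi n) (.of_forall (hY0 n))]
        exact ENNReal.ofReal_le_ofReal (hYle n)
    refine ne_top_of_le_ne_top ?_ (ENNReal.tsum_le_tsum hle)
    exact ((summable_geometric_of_lt_one hq0.le hq1).mul_left _).tsum_ofReal_ne_top
  filter_upwards [ae_lt_top' (AEMeasurable.tsum fun n =>
    (hYi n).aestronglyMeasurable.aemeasurable.ennreal_ofReal) hfin] with ω hω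
  have := ENNReal.summable_toReal hω.ne
  simpa only [ENNReal.toReal_ofReal (hY0 _ ω)] using this

theorem ClassA.ae_continuousOn [IsProbabilityMeasure μ] {x : ℝ → Ω → ℝ}
    (hπ : π.FinitelyRefining) (hx : π.ClassA μ x)
    (hb : π.Balanced) (hc : π.CompleteRefining) :
    ∀ᵐ ω ∂μ, ContinuousOn (fun s => x s ω) (Icc 0 1) := by
  obtain ⟨η, M, hη, hlim⟩ := hx.exists_coeff
  obtain ⟨B, hB⟩ := hπ.exists_card_branchIndex_le
  obtain ⟨r, hr0, hr1, hr⟩ := hc.exists_rate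
  -- With q = r^{1/4} the mesh is bounded by q^{4n}: three powers absorb the truncation q^{-3n}, and
  -- one is left for summability.
  have hq4 : √√r ^ 4 = r := by
    rw [show √√r ^ 4 = (√√r ^ 2) ^ 2 by ring, Real.sq_sqrt (Real.sqrt_nonneg _),
      Real.sq_sqrt hr0.le]
  have hq0 : 0 < √√r := Real.sqrt_pos.2 (Real.sqrt_pos.2 hr0)
  have hq1 : √√r < 1 := by
    rw [Real.sqrt_lt' one_pos, Real.sqrt_lt' (by positivity)]
    simpa using hr1
  set q := √√r
  filter_upwards [hlim, ae_summable_levelIndex_pow_four hb hc hπ.refining hη hq0 hq1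
    (fun n => by rw [hq4]; exact hr n)] with ω hω hsum
  have hcont := hπ.refining.continuousOn_of_tendsto (θ := fun a => η a ω)
    (u := fun n => q ^ n + B * (π.mesh (n + 1) ^ 2 *
      (∑ a ∈ π.levelIndex (n + 1), η a ω ^ 4) / (q ^ n) ^ 3))
    ((summable_geometric_of_lt_one hq0.le hq1).add (hsum.mul_left _)) (fun n s hs => by
      have h1 := hπ.refining.levelSum_pow_four_le (fun a => η a ω) (hB (n + 1) (by omega)) hs
      refine (abs_le_add_div_of_pow_four_le (pow_pos hq0 n) h1).trans (le_of_eq ?_)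
      ring) hω
  have haff : Continuous fun s => x 0 ω + (x 1 ω - x 0 ω) * s := by fun_prop
  exact (hcont.add haff.continuousOn).congr fun s _ => by simp

end ClassA

end PartitionSeq

/-! ### From convergence at rational times to weak convergence, for continuous paths. -/

namespace UnitPartition

variable (P : UnitPartition) (y : ℝ → ℝ)

/-- The quadratic variation accumulated over the intervals of `P` that end before `t`. -/
def closedQv (t : ℝ) : ℝ :=
  ∑ i ∈ Finset.range P.N, if P.t (i + 1) ≤ t then (y (P.t (i + 1)) - y (P.t i)) ^ 2 else 0

theorem closedQv_nonneg (t : ℝ) : 0 ≤ P.closedQv y t :=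
  Finset.sum_nonneg fun _ _ => by split_ifs <;> positivity

theorem closedQv_mono {s t : ℝ} (h : s ≤ t) : P.closedQv y s ≤ P.closedQv y t := by
  refine Finset.sum_le_sum fun i _ => ?_
  by_cases h1 : P.t (i + 1) ≤ s
  · rw [if_pos h1, if_pos (h1.trans h)]
  · rw [if_neg h1]
    split_ifs <;> positivity

theorem closedQv_one :
    P.closedQv y 1 = ∑ i ∈ Finset.range P.N, (y (P.t (i + 1)) - y (P.t i)) ^ 2 :=
  Finset.sum_congr rfl fun _ hi => if_pos (P.t_le_one (Finset.mem_range.1 hi))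

/-- The two sums differ only in the interval containing t, by the square of y(t) - y(t_i). The step
function `f` again isolates this interval and telescopes. -/
theorem qv_sub_closedQv_mem {t w : ℝ} (ht : t ∈ Icc (0 : ℝ) 1)
    (hw : ∀ u ∈ Icc (0 : ℝ) 1, ∀ v ∈ Icc (0 : ℝ) 1, |u - v| ≤ P.mesh → |y u - y v| ≤ w) :
    P.qv y t - P.closedQv y t ∈ Icc 0 (w ^ 2) := by
  let f : ℝ → ℝ := fun u => if t < u then 1 else 0
  have key : ∀ i < P.N, P.incr y t i ^ 2 -
      (if P.t (i + 1) ≤ t then (y (P.t (i + 1)) - y (P.t i)) ^ 2 else 0) ∈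
      Icc 0 (w ^ 2 * (f (P.t (i + 1)) - f (P.t i))) := by
    intro i hi
    have hlt := P.t_lt i hi
    by_cases h1 : P.t (i + 1) ≤ t
    · simp [incr, f, h1, hlt.le.trans h1, not_lt.2 h1, not_lt.2 (hlt.le.trans h1)]
    · rw [if_neg h1, sub_zero]
      refine ⟨sq_nonneg _, ?_⟩
      have h1' := not_le.1 h1
      by_cases h2 : t < P.t i
      · simp [incr, f, h2, h1', h2.le, h1'.le]
      · have h2' := not_lt.1 h2
        simp only [incr, f, if_pos h1', if_neg h2, sub_zero, mul_one, min_eq_left h2',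
          min_eq_right h1'.le]
        refine sq_le_sq' ?_ ?_
        all_goals
          have h3 := abs_le.1 (hw t ht (P.t i) ⟨P.t_nonneg hi.le, P.t_le_one hi.le⟩ (by
            rw [abs_of_nonneg (sub_nonneg.2 h2')]
            linarith [P.length_le_mesh hi]))
          linarith [h3.1, h3.2]
  rw [qv_eq, closedQv, ← Finset.sum_sub_distrib]
  refine ⟨Finset.sum_nonneg fun i hi => (key i (Finset.mem_range.1 hi)).1, ?_⟩
  refine (Finset.sum_le_sum fun i hi => (key i (Finset.mem_range.1 hi)).2).trans ?_
  rw [← Finset.mul_sum, P.sum_sub]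
  refine mul_le_of_le_one_right (sq_nonneg _) ?_
  simp only [f]
  split_ifs <;> norm_num

theorem integral_qvMeasure (f : ℝ → ℝ) :
    ∫ u, f u ∂(P.qvMeasure y : Measure ℝ) =
      ∑ i ∈ Finset.range P.N, (y (P.t (i + 1)) - y (P.t i)) ^ 2 * f (P.t i) := by
  have h1 : ∀ (c : NNReal) (s : ℝ),
      ((c • pointMass s : FiniteMeasure ℝ) : Measure ℝ) = c • Measure.dirac s := fun _ _ => rfl
  rw [qvMeasure, FiniteMeasure.toMeasure_sum, integral_finsetSum_measure]
  · refine Finset.sum_congr rfl fun i _ => ?_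
    rw [h1, integral_smul_nnreal_measure, integral_dirac, NNReal.smul_def,
      Real.coe_toNNReal _ (sq_nonneg _), smul_eq_mul]
  · intro i _
    rw [h1]
    exact (integrable_dirac (by simp)).smul_measure_nnreal

variable {y} {P : ℕ → UnitPartition}

theorem tendsto_qv_sub_closedQv (hP : Tendsto (fun n => (P n).mesh) atTop (𝓝 0))
    (hy : ContinuousOn y (Icc 0 1)) {t : ℝ} (ht : t ∈ Icc (0 : ℝ) 1) :
    Tendsto (fun n => (P n).qv y t - (P n).closedQv y t) atTop (𝓝 0) := by
  have huc := isCompact_Icc.uniformContinuousOn_of_continuous hy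
  rw [Metric.uniformContinuousOn_iff] at huc
  refine tendsto_order.2 ⟨fun a ha => ?_, fun b hb => ?_⟩
  · obtain ⟨δ, hδ, h⟩ := huc 1 one_pos
    filter_upwards [hP.eventually_lt_const hδ] with n hn
    refine ha.trans_le ((P n).qv_sub_closedQv_mem y ht (w := 1) fun u hu v hv huv => ?_).1
    exact (h u hu v hv (huv.trans_lt hn)).le
  · obtain ⟨δ, hδ, h⟩ := huc √(b / 2) (Real.sqrt_pos.2 (by positivity))
    filter_upwards [hP.eventually_lt_const hδ] with n hn
    refine (((P n).qv_sub_closedQv_mem y ht (w := √(b / 2)) fun u hu v hv huv => ?_).2).trans_lt ?_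
    · exact (h u hu v hv (huv.trans_lt hn)).le
    · rw [Real.sq_sqrt (by positivity)]
      linarith

/-- `closedQv` is monotone in t, which `qv` need not be, and the limit is continuous, so nearby
rational times squeeze the value at t. -/
theorem tendsto_closedQv_of_rat
    (h : ∀ q : ℚ, (q : ℝ) ∈ Icc (0 : ℝ) 1 →
      Tendsto (fun n => (P n).closedQv y q) atTop (𝓝 (q : ℝ))) {t : ℝ} (ht : t ∈ Icc (0 : ℝ) 1) :
    Tendsto (fun n => (P n).closedQv y t) atTop (𝓝 t) := by
  refine tendsto_order.2 ⟨fun a ha => ?_, fun b hb => ?_⟩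
  · by_cases ha0 : a < 0
    · exact .of_forall fun n => ha0.trans_le ((P n).closedQv_nonneg y t)
    · obtain ⟨q, hq1, hq2⟩ := exists_rat_btwn ha
      filter_upwards [(h q ⟨(not_lt.1 ha0).trans hq1.le, hq2.le.trans ht.2⟩).eventually_const_lt hq1]
        with n hn
      exact hn.trans_le ((P n).closedQv_mono y hq2.le)
  · obtain ⟨q, hq1, hq2, hq3⟩ : ∃ q : ℚ, t ≤ q ∧ (q : ℝ) < b ∧ (q : ℝ) ≤ 1 := by
      rcases ht.2.lt_or_eq with h1 | h1
      · obtain ⟨q, hq1, hq2⟩ := exists_rat_btwn (lt_min hb h1)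
        exact ⟨q, hq1.le, hq2.trans_le (min_le_left _ _), hq2.le.trans (min_le_right _ _)⟩
      -- At t = 1 there is no room to the right inside [0,1], but 1 is itself rational.
      · exact ⟨1, by simp [h1], by simpa [h1] using hb, by simp⟩
    filter_upwards [(h q ⟨ht.1.trans hq1, hq3⟩).eventually_lt_const hq2] with n hn
    exact ((P n).closedQv_mono y hq1).trans_lt hn

/-- The bracket is the indicator of (j/K, (j+1)/K], and exactly one of these intervals contains u.
-/
theorem exists_grid_cell (f : ℝ → ℝ) {K : ℕ} (hK : 0 < K) {u : ℝ} (hu : u ∈ Ioc (0 : ℝ) 1) :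
    ∃ k < K, (k : ℝ) / K < u ∧ u ≤ ((k + 1 : ℕ) : ℝ) / K ∧
      ∑ j ∈ Finset.range K, f ((j : ℝ) / K) * ((if u ≤ ((j + 1 : ℕ) : ℝ) / K then 1 else 0) -
        (if u ≤ (j : ℝ) / K then 1 else 0)) = f ((k : ℝ) / K) := by
  have hK' : (0 : ℝ) < K := Nat.cast_pos.2 hK
  have hpos : 0 < u * K := mul_pos hu.1 hK'
  obtain ⟨k, hk⟩ := Nat.exists_eq_succ_of_ne_zero (Nat.ceil_pos.2 hpos).ne'
  have h1 : (k : ℝ) < u * K := Nat.lt_ceil.1 (by omega)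
  have h2 : u * K ≤ ((k + 1 : ℕ) : ℝ) := by
    have := Nat.le_ceil (u * K)
    rwa [hk] at this
  have hkK : k < K := by
    have : (k : ℝ) < K := h1.trans_le (mul_le_of_le_one_left hK'.le hu.2)
    exact_mod_cast this
  have h1' : (k : ℝ) / K < u := (div_lt_iff₀ hK').2 h1
  have h2' : u ≤ ((k + 1 : ℕ) : ℝ) / K := (le_div_iff₀ hK').2 h2
  refine ⟨k, hkK, h1', h2', ?_⟩
  rw [Finset.sum_eq_single_of_mem k (Finset.mem_range.2 hkK)]
  · rw [if_pos h2', if_neg (not_le.2 h1'), sub_zero, mul_one]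
  · intro j _ hj
    rcases lt_or_gt_of_ne hj with hlt | hlt
    · have h3 : ((j + 1 : ℕ) : ℝ) / K ≤ (k : ℝ) / K := by gcongr; omega
      have h4 : (j : ℝ) / K ≤ (k : ℝ) / K := by gcongr
      rw [if_neg (not_le.2 (h3.trans_lt h1')), if_neg (not_le.2 (h4.trans_lt h1')), sub_self,
        mul_zero]
    · have h3 : ((k + 1 : ℕ) : ℝ) / K ≤ (j : ℝ) / K := by gcongr; omega
      have h4 : (j : ℝ) / K ≤ ((j + 1 : ℕ) : ℝ) / K := by gcongr; omega
      rw [if_pos ((h2'.trans h3).trans h4), if_pos (h2'.trans h3), sub_self, mul_zero]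

/-- `closedQv` places the mass of an interval at its right endpoint, `qvMeasure` at its left.
Rounding the right endpoint down to the grid then displaces mass by at most 1/K + |P|. -/
theorem abs_sum_sub_grid_le (P : UnitPartition) {f : ℝ → ℝ} {ε δ : ℝ}
    (hf : ∀ u ∈ Icc (0 : ℝ) 1, ∀ v ∈ Icc (0 : ℝ) 1, |u - v| ≤ δ → |f u - f v| ≤ ε) {K : ℕ}
    (hK : 0 < K) (hKδ : 1 / (K : ℝ) + P.mesh ≤ δ) :
    |∑ i ∈ Finset.range P.N, (y (P.t (i + 1)) - y (P.t i)) ^ 2 * f (P.t i) -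
      ∑ j ∈ Finset.range K, f ((j : ℝ) / K) *
        (P.closedQv y (((j + 1 : ℕ) : ℝ) / K) - P.closedQv y ((j : ℝ) / K))| ≤
      ε * P.closedQv y 1 := by
  have hK' : (0 : ℝ) < K := Nat.cast_pos.2 hK
  have h1 : ∑ j ∈ Finset.range K, f ((j : ℝ) / K) *
        (P.closedQv y (((j + 1 : ℕ) : ℝ) / K) - P.closedQv y ((j : ℝ) / K)) =
      ∑ i ∈ Finset.range P.N, (y (P.t (i + 1)) - y (P.t i)) ^ 2 *
        ∑ j ∈ Finset.range K, f ((j : ℝ) / K) *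
          ((if P.t (i + 1) ≤ ((j + 1 : ℕ) : ℝ) / K then 1 else 0) -
            (if P.t (i + 1) ≤ (j : ℝ) / K then 1 else 0)) := by
    simp_rw [closedQv, ← Finset.sum_sub_distrib, Finset.mul_sum]
    rw [Finset.sum_comm]
    refine Finset.sum_congr rfl fun i _ => Finset.sum_congr rfl fun j _ => ?_
    split_ifs <;> ring
  rw [h1, ← Finset.sum_sub_distrib, P.closedQv_one, Finset.mul_sum]
  refine (Finset.abs_sum_le_sum_abs _ _).trans (Finset.sum_le_sum fun i hi => ?_)
  have hi := Finset.mem_range.1 hi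
  have hpos : 0 < P.t (i + 1) := (P.t_nonneg hi.le).trans_lt (P.t_lt i hi)
  obtain ⟨k, hk, hk1, hk2, hk3⟩ := exists_grid_cell f hK ⟨hpos, P.t_le_one hi⟩
  rw [hk3, ← mul_sub, abs_mul, abs_of_nonneg (sq_nonneg _), mul_comm]
  refine mul_le_mul_of_nonneg_right ?_ (sq_nonneg _)
  refine hf _ ⟨P.t_nonneg hi.le, P.t_le_one hi.le⟩ _ ⟨by positivity, ?_⟩ ?_
  · rw [div_le_one hK']
    exact_mod_cast hk.le
  · have h2 := P.length_le_mesh hi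
    have h3 := P.t_lt i hi
    have h4 : ((k + 1 : ℕ) : ℝ) / K = (k : ℝ) / K + 1 / K := by push_cast; ring
    rw [h4] at hk2
    have h5 : 0 < 1 / (K : ℝ) := by positivity
    rw [abs_le]
    constructor <;> linarith

theorem abs_integral_sub_grid_le {f : ℝ → ℝ} (hfc : Continuous f) {ε δ : ℝ}
    (hf : ∀ u ∈ Icc (0 : ℝ) 1, ∀ v ∈ Icc (0 : ℝ) 1, |u - v| ≤ δ → |f u - f v| ≤ ε) {K : ℕ}
    (hK : 0 < K) (hKδ : 1 / (K : ℝ) ≤ δ) :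
    |(∫ u in (0 : ℝ)..1, f u) - ∑ j ∈ Finset.range K, f ((j : ℝ) / K) *
        (((j + 1 : ℕ) : ℝ) / K - (j : ℝ) / K)| ≤ ε := by
  have hK' : (0 : ℝ) < K := Nat.cast_pos.2 hK
  have h1 := intervalIntegral.sum_integral_adjacent_intervals (μ := volume) (f := f)
    (a := fun j : ℕ => (j : ℝ) / K) (n := K) fun k _ => hfc.intervalIntegrable _ _
  rw [Nat.cast_zero, zero_div, div_self hK'.ne'] at h1
  rw [← h1, ← Finset.sum_sub_distrib]
  have hlen : ∀ j : ℕ, ((j + 1 : ℕ) : ℝ) / K - (j : ℝ) / K = 1 / K := fun j => by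
    push_cast; ring
  have h2 : ∀ j ∈ Finset.range K, |(∫ u in ((j : ℝ) / K)..(((j + 1 : ℕ) : ℝ) / K), f u) -
      f ((j : ℝ) / K) * (((j + 1 : ℕ) : ℝ) / K - (j : ℝ) / K)| ≤ ε * (1 / K) := by
    intro j hj
    have hj := Finset.mem_range.1 hj
    have hle : (j : ℝ) / K ≤ ((j + 1 : ℕ) : ℝ) / K := by gcongr; omega
    have h3 : (∫ u in ((j : ℝ) / K)..(((j + 1 : ℕ) : ℝ) / K), f u) -
        f ((j : ℝ) / K) * (((j + 1 : ℕ) : ℝ) / K - (j : ℝ) / K) =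
        ∫ u in ((j : ℝ) / K)..(((j + 1 : ℕ) : ℝ) / K), (f u - f ((j : ℝ) / K)) := by
      rw [intervalIntegral.integral_sub (hfc.intervalIntegrable _ _) (by simp),
        intervalIntegral.integral_const, smul_eq_mul, mul_comm]
    rw [h3]
    have h4 := intervalIntegral.norm_integral_le_of_norm_le_const (a := (j : ℝ) / K)
      (b := ((j + 1 : ℕ) : ℝ) / K) (C := ε) (f := fun u => f u - f ((j : ℝ) / K)) ?_
    · rwa [hlen, abs_of_pos (by positivity)] at h4
    · intro u hu
      rw [uIoc_of_le hle] at hu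
      have hj1 : ((j + 1 : ℕ) : ℝ) / K ≤ 1 := by
        rw [div_le_one hK']
        exact_mod_cast hj
      have hj0 : 0 ≤ (j : ℝ) / K := by positivity
      refine hf _ ⟨hj0.trans hu.1.le, hu.2.trans hj1⟩ _ ⟨hj0, hle.trans hj1⟩ ?_
      rw [abs_of_pos (sub_pos.2 hu.1)]
      linarith [hlen j, hu.2]
  calc _ ≤ ∑ j ∈ Finset.range K, ε * (1 / K) :=
        (Finset.abs_sum_le_sum_abs _ _).trans (Finset.sum_le_sum h2)
    _ = ε := by
        rw [Finset.sum_const, Finset.card_range, nsmul_eq_mul]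
        field_simp

/-- Lebesgue measure on the unit interval. -/
def unitVolume : FiniteMeasure ℝ := ⟨volume.restrict (Icc 0 1), inferInstance⟩

theorem tendsto_qvMeasure (hP : Tendsto (fun n => (P n).mesh) atTop (𝓝 0))
    (h : ∀ t ∈ Icc (0 : ℝ) 1, Tendsto (fun n => (P n).closedQv y t) atTop (𝓝 t)) :
    Tendsto (fun n => (P n).qvMeasure y) atTop (𝓝 unitVolume) := by
  refine FiniteMeasure.tendsto_of_forall_integral_tendsto fun f => ?_
  simp_rw [integral_qvMeasure]
  have hvol : ∫ u, f u ∂(unitVolume : Measure ℝ) = ∫ u in (0 : ℝ)..1, f u := by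
    rw [intervalIntegral.integral_of_le zero_le_one, ← integral_Icc_eq_integral_Ioc]
    rfl
  rw [hvol, Metric.tendsto_atTop']
  intro ε hε
  have huc := isCompact_Icc.uniformContinuousOn_of_continuous
    (f.continuous.continuousOn (s := Icc (0 : ℝ) 1))
  rw [Metric.uniformContinuousOn_iff] at huc
  -- Error budget: 2ε/5 for the grid approximation, since the total mass is eventually below 2, ε/5
  -- for the limit of the grid sums and ε/5 for the Riemann sum.
  obtain ⟨δ, hδ, hδf⟩ := huc (ε / 5) (by positivity)
  have hf : ∀ u ∈ Icc (0 : ℝ) 1, ∀ v ∈ Icc (0 : ℝ) 1, |u - v| ≤ δ / 2 → |f u - f v| ≤ ε / 5 :=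
    fun u hu v hv huv => (hδf u hu v hv (huv.trans_lt (by linarith))).le
  obtain ⟨K₀, hK₀⟩ := exists_nat_one_div_lt (show 0 < δ / 4 by positivity)
  obtain ⟨K, hK, hKδ⟩ : ∃ K : ℕ, 0 < K ∧ 1 / (K : ℝ) < δ / 4 :=
    ⟨K₀ + 1, Nat.succ_pos _, by exact_mod_cast hK₀⟩
  have hK' : (0 : ℝ) < K := Nat.cast_pos.2 hK
  have hgrid : ∀ j ≤ K, (j : ℝ) / K ∈ Icc (0 : ℝ) 1 := fun j hj =>
    ⟨by positivity, (div_le_one hK').2 (by exact_mod_cast hj)⟩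
  have hlim : Tendsto (fun n => ∑ j ∈ Finset.range K, f ((j : ℝ) / K) *
        ((P n).closedQv y (((j + 1 : ℕ) : ℝ) / K) - (P n).closedQv y ((j : ℝ) / K))) atTop
      (𝓝 (∑ j ∈ Finset.range K, f ((j : ℝ) / K) * (((j + 1 : ℕ) : ℝ) / K - (j : ℝ) / K))) :=
    tendsto_finsetSum _ fun j hj => ((h _ (hgrid (j + 1) (Finset.mem_range.1 hj))).sub
      (h _ (hgrid j (Finset.mem_range.1 hj).le))).const_mul _
  have hI := abs_integral_sub_grid_le f.continuous hf hK (by linarith)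
  have hev := ((Metric.tendsto_nhds.1 hlim (ε / 5) (by positivity)).and
    (hP.eventually_lt_const (show 0 < δ / 4 by positivity))).and
    ((h 1 ⟨zero_le_one, le_rfl⟩).eventually_lt_const one_lt_two)
  obtain ⟨n₀, hn₀⟩ := eventually_atTop.1 hev
  refine ⟨n₀, fun n hn => ?_⟩
  obtain ⟨⟨h1, h2⟩, h3⟩ := hn₀ n hn.le
  have h4 := (P n).abs_sum_sub_grid_le (y := y) hf hK (by linarith)
  have h5 : ε / 5 * (P n).closedQv y 1 ≤ ε / 5 * 2 := by gcongr
  rw [Real.dist_eq] at h1 ⊢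
  rw [abs_lt] at h1 ⊢
  rw [abs_le] at h4 hI
  constructor <;> linarith [h1.1, h1.2, h4.1, h4.2, hI.1, hI.2]

end UnitPartition

theorem ContinuousOn.tendsto_nhdsLT_of_mem_Ioc {y : ℝ → ℝ} {a b s : ℝ}
    (hy : ContinuousOn y (Icc a b)) (hs : s ∈ Ioc a b) : Tendsto y (𝓝[<] s) (𝓝 (y s)) :=
  (hy s ⟨hs.1.le, hs.2⟩).mono_left (nhdsWithin_le_of_mem (Icc_mem_nhdsLT_of_mem hs))

theorem ContinuousOn.jump_eq_zero {y : ℝ → ℝ} (hy : ContinuousOn y (Icc 0 1)) {s : ℝ}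
    (hs : s ∈ Ioc (0 : ℝ) 1) : jump y s = 0 := by
  rw [jump, leftLim_eq_of_tendsto (hy.tendsto_nhdsLT_of_mem_Ioc hs),
    sub_self]

/-! ### Pathwise quadratic variation and conclusion. -/

namespace PartitionSeq

/-- A continuous path whose quadratic variation along `π` converges to `t` at rational times has
quadratic variation `t` along `π`. -/
theorem hasQuadVar_of_tendsto_rat {π : PartitionSeq} (hπ : Tendsto π.mesh atTop (𝓝 0))
    {y : ℝ → ℝ} (hy : ContinuousOn y (Icc 0 1))
    (h : ∀ q : ℚ, (q : ℝ) ∈ Icc (0 : ℝ) 1 →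
      Tendsto (fun n => (π.part n).qv y q) atTop (𝓝 (q : ℝ))) :
    π.HasQuadVar y fun t => t := by
  have hsub : ∀ t ∈ Icc (0 : ℝ) 1,
      Tendsto (fun n => (π.part n).qv y t - (π.part n).closedQv y t) atTop (𝓝 0) :=
    fun t ht => UnitPartition.tendsto_qv_sub_closedQv hπ hy ht
  have hclosed : ∀ t ∈ Icc (0 : ℝ) 1,
      Tendsto (fun n => (π.part n).closedQv y t) atTop (𝓝 t) := fun t ht =>
    UnitPartition.tendsto_closedQv_of_rat (fun q hq => by
      simpa using (h q hq).sub (hsub q hq)) ht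
  have hreal : ∀ t ∈ Icc (0 : ℝ) 1,
      (UnitPartition.unitVolume : Measure ℝ).real (Icc 0 t) = t := by
    intro t ht
    change (volume.restrict (Icc (0 : ℝ) 1)).real (Icc 0 t) = t
    rw [measureReal_restrict_apply measurableSet_Icc,
      inter_eq_left.2 (Icc_subset_Icc_right ht.2), Real.volume_real_Icc_of_le ht.1, sub_zero]
  have hdiff : EqOn (fun t => (UnitPartition.unitVolume : Measure ℝ).real (Icc 0 t) -
      ∑' s : Ioc (0 : ℝ) t, jump y s ^ 2) id (Icc 0 1) := by
    intro t ht
    have h0 : ∀ s : Ioc (0 : ℝ) t, jump y s ^ 2 = 0 := fun s => by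
      rw [hy.jump_eq_zero ⟨s.2.1, s.2.2.trans ht.2⟩]
      norm_num
    simp only [hreal t ht, h0, tsum_zero, sub_zero, id]
  refine ⟨⟨fun t ht => ?_, fun t ht => ⟨y t, hy.tendsto_nhdsLT_of_mem_Ioc ht⟩⟩, ?_,
    ⟨UnitPartition.unitVolume, UnitPartition.tendsto_qvMeasure hπ hclosed,
      continuousOn_id.congr hdiff, ?_, fun t ht => (hreal t ht).symm⟩, fun t ht => ?_⟩
  · exact (hy t ⟨ht.1, ht.2.le⟩).mono (Icc_subset_Icc_left ht.1)
  · have h0 : (fun s : Ioc (0 : ℝ) 1 => jump y s ^ 2) = 0 := by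
      funext s
      simp [hy.jump_eq_zero s.2]
    rw [h0]
    exact summable_zero
  · exact (monotoneOn_id).congr hdiff.symm
  · simpa using (hsub t ht).add (hclosed t ht)

/-- Any admissible choice is fixed on [0,1] by uniqueness of the limit of `qv`. -/
theorem HasQuadVar.quadVar_eq {π : PartitionSeq} {y q : ℝ → ℝ} (h : π.HasQuadVar y q) {t : ℝ}
    (ht : t ∈ Icc (0 : ℝ) 1) : π.quadVar y t = q t := by
  have hex : ∃ q, π.HasQuadVar y q := ⟨q, h⟩
  rw [quadVar, dif_pos hex]
  exact tendsto_nhds_unique ((Classical.choose_spec hex).tendsto_qv t ht) (h.tendsto_qv t ht)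

theorem ClassA.ae_hasQuadVar {Ω : Type*} [MeasurableSpace Ω] {μ : Measure Ω}
    [IsProbabilityMeasure μ] {π σ : PartitionSeq} {x : ℝ → Ω → ℝ} (hπ : π.FinitelyRefining)
    (hx : π.ClassA μ x) (hcont : ∀ᵐ ω ∂μ, ContinuousOn (fun s => x s ω) (Icc 0 1))
    (hσ : Summable σ.mesh) :
    ∀ᵐ ω ∂μ, σ.HasQuadVar (fun s => x s ω) fun t => t := by
  have hrat : ∀ᵐ ω ∂μ, ∀ q : ℚ, (q : ℝ) ∈ Icc (0 : ℝ) 1 →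
      Tendsto (fun n => (σ.part n).qv (fun s => x s ω) q) atTop (𝓝 (q : ℝ)) := by
    -- The exceptional null set depends on the time; countability of the rationals gives a common
    -- one.
    rw [ae_all_iff]
    intro q
    by_cases hq : (q : ℝ) ∈ Icc (0 : ℝ) 1
    · filter_upwards [hx.ae_tendsto_qv hπ hσ hq] with ω hω _
      exact hω
    · exact .of_forall fun ω h => absurd h hq
  filter_upwards [hcont, hrat] with ω h1 h2
  exact hasQuadVar_of_tendsto_rat hσ.tendsto_atTop_zero h1 h2

end PartitionSeq

end

theorem mainTheorem1 {Ω : Type*} [MeasurableSpace Ω] (μ : Measure Ω) [IsProbabilityMeasure μ]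
    (π : PartitionSeq) (hπ : π.FinitelyRefining)
    (x : ℝ → Ω → ℝ) (hx : π.ClassA μ x)
    (σ : PartitionSeq) (hσ : σ.IsCoarsening π) :
    (∀ t ∈ Icc (0 : ℝ) 1,
      TendstoInMeasure μ (fun n ω => (σ.part n).qv (fun s => x s ω) t) atTop (fun _ => t) ∧
      TendstoInMeasure μ (fun n ω => (π.part n).qv (fun s => x s ω) t) atTop (fun _ => t)) ∧
    (π.CompleteRefining → π.Balanced → σ.CompleteRefining → σ.Balanced →
      ∀ᵐ ω ∂μ, (fun s => x s ω) ∈ π.Q ∩ σ.Q ∧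
        ∀ t ∈ Icc (0 : ℝ) 1, π.quadVar (fun s => x s ω) t = σ.quadVar (fun s => x s ω) t) := by
  refine ⟨fun t ht => ⟨hx.tendstoInMeasure_qv hπ hσ.finitelyRefining.mesh_tendsto ht,
    hx.tendstoInMeasure_qv hπ hπ.mesh_tendsto ht⟩, fun hπc hπb hσc _ => ?_⟩
  have hcont := hx.ae_continuousOn hπ hπb hπc
  filter_upwards [hx.ae_hasQuadVar hπ hcont hπc.summable_mesh,
    hx.ae_hasQuadVar hπ hcont hσc.summable_mesh] with ω h1 h2
  exact ⟨⟨⟨_, h1⟩, ⟨_, h2⟩⟩, fun t ht => by rw [h1.quadVar_eq ht, h2.quadVar_eq ht]⟩
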